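/- A graph is a set $V$ of vertices with a reflexive symmetric relation $E\subseteq V^2$. A topological graph is a graph $(V,E)$ in which $V$ is a zero-dimensional compact second-countable Hausdorff space and $E$ is closed in $V^2$; finite graphs carry the discrete topology. A set $S$ of vertices is disconnected if $S=P\cup Q$ with $P,Q$ nonempty and closed in $S$ and with no edge between $P$ and $Q$; otherwise it is connected. A graph is called connected if $V$ is nonempty and connected. The component of $S$ containing $a\in S$ is the union of all connected subsets of $S$ that contain $a$. An epimorphism is a continuous map $f\colon G\to H$ of topological graphs that maps edges to edges and is surjective on vertices and on edges. It is confluent if $f(C)=Q$ for every connected set $Q$ of vertices of $H$ and every component $C$ of $f^{-1}(Q)$. Let $\mathcal G$ be the class of finite connected graphs with confluent epimorphisms. A projective Fraïssé limit of $\mathcal G$ is a topological graph $\mathbb G$ such that (1) for each $A\in\mathcal G$ there is a confluent epimorphism $\mathbb G\to A$; (2) for all $A,B\in\mathcal G$ and confluent epimorphisms $f\colon\mathbb G\to A$ and $g\colon B\to A$ there is a confluent epimorphism $h\colon\mathbb G\to B$ with $f=g\circ h$; (3) for every compatible metric on the vertex space of $\mathbb G$ and every $\varepsilon>0$ there are $A\in\mathcal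 G$ and a confluent epimorphism $f\colon\mathbb G\to A$ all of whose fibres have diameter less than $\varepsilon$. Theorem. A projective Fraïssé limit of $\mathcal G$ exists. For every such limit $\mathbb G$ the edge relation $E(\mathbb G)$ is transitive, hence an equivalence relation; the topological realization $|\mathbb G|=V(\mathbb G)/E(\mathbb G)$ with the quotient topology is a continuum (a nonempty compact connected metrizable space); and $|\mathbb G|$ is not homogeneous: there are points $x,y\in|\mathbb G|$ such that no homeomorphism of $|\mathbb G|$ onto itself maps $x$ to $y$. -/

import Mathlib

universe u v

/-- A graph on the vertex space `V`: a closed, reflexive and symmetric relation `Edge` on `V`.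
When `V` is compact, Hausdorff, totally disconnected (equivalently, for compact Hausdorff spaces,
zero-dimensional) and second countable, this is a topological graph. A finite graph is a graph on
a finite discrete space, where closedness of the edge relation is automatic. -/
structure TopGraph (V : Type u) [TopologicalSpace V] where
  Edge : V → V → Prop
  refl : ∀ a, Edge a a
  symm : ∀ a b, Edge a b → Edge b a
  closed : IsClosed {p : V × V | Edge p.1 p.2}

namespace TopGraph

variable {V : Type u} [TopologicalSpace V] {W : Type v} [TopologicalSpace W]

/-- A set `S` of vertices is disconnected if it is the union of two nonempty relatively closed
subsets with no edge between them. -/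
def DisconnectedSet (G : TopGraph V) (S : Set V) : Prop :=
  ∃ P Q : Set V, P.Nonempty ∧ Q.Nonempty ∧
    IsClosed ((↑) ⁻¹' P : Set S) ∧ IsClosed ((↑) ⁻¹' Q : Set S) ∧
    P ∪ Q = S ∧ ∀ a ∈ P, ∀ b ∈ Q, ¬ G.Edge a b

def ConnectedSet (G : TopGraph V) (S : Set V) : Prop := ¬ G.DisconnectedSet S

/-- A graph is connected if its (here: nonempty) set of vertices is connected. -/
def Connected (G : TopGraph V) : Prop := Nonempty V ∧ G.ConnectedSet Set.univ

/-- The component of `S` containing `a`. -/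
def component (G : TopGraph V) (S : Set V) (a : V) : Set V :=
  ⋃₀ {P : Set V | P ⊆ S ∧ a ∈ P ∧ G.ConnectedSet P}

/-- Epimorphisms: continuous maps that preserve edges and are onto on vertices and on edges. -/
structure IsEpi (G : TopGraph V) (H : TopGraph W) (f : V → W) : Prop where
  continuous : Continuous f
  map_edge : ∀ a b, G.Edge a b → H.Edge (f a) (f b)
  surjective : Function.Surjective f
  surjective_edge : ∀ c d, H.Edge c d → ∃ a b, G.Edge a b ∧ f a = c ∧ f b = d

/-- Confluent epimorphisms: every component of the preimage of a connected set `Q` is mapped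
onto `Q`. -/
structure IsConfluentEpi (G : TopGraph V) (H : TopGraph W) (f : V → W) : Prop
    extends IsEpi G H f where
  confluent : ∀ Q : Set W, H.ConnectedSet Q → ∀ a ∈ f ⁻¹' Q, f '' G.component (f ⁻¹' Q) a = Q

/-- The quotient space of `V` by the edge relation. It is the topological realization of `G` when
`Edge` is transitive; `Edge` is then an equivalence relation. -/
def Realization (G : TopGraph V) : Type u := Quot G.Edge

instance (G : TopGraph V) : TopologicalSpace G.Realization :=
  inferInstanceAs (TopologicalSpace (Quot G.Edge))

end TopGraph

/-- `f` is an `ε`-map with respect to the metric `m`: all fibres have diameter less than `ε`. -/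
def IsEpsMap {V : Type u} (m : MetricSpace V) {W : Type v} (ε : ℝ) (f : V → W) : Prop :=
  ∀ y : W, Metric.diam (f ⁻¹' {y}) < ε

/-- `G` is a projective Fraïssé limit of the class of finite connected graphs with confluent
epimorphisms: a topological graph which maps onto every member of the class, has the extension
property for confluent epimorphisms, and is approximated by members of the class. (The vertex space
is metrizable; by compactness the last condition does not depend on the compatible metric.) -/
structure IsConfluentFraisseLimit {V : Type u} [t : TopologicalSpace V] (G : TopGraph V) : Prop where
  compactSpace : CompactSpace V
  t2Space : T2Space V
  totallyDisconnectedSpace : TotallyDisconnectedSpace V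
  secondCountableTopology : SecondCountableTopology V
  projective_universal : ∀ (A : Type) [Finite A] [TopologicalSpace A] [DiscreteTopology A]
    (K : TopGraph A), K.Connected → ∃ f : V → A, G.IsConfluentEpi K f
  extension : ∀ (A B : Type) [Finite A] [TopologicalSpace A] [DiscreteTopology A]
    [Finite B] [TopologicalSpace B] [DiscreteTopology B] (K : TopGraph A) (L : TopGraph B),
    K.Connected → L.Connected → ∀ (f : V → A) (g : B → A),
    G.IsConfluentEpi K f → L.IsConfluentEpi K g → ∃ h : V → B, G.IsConfluentEpi L h ∧ f = g ∘ h
  approximation : ∀ m : MetricSpace V,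
    m.toPseudoMetricSpace.toUniformSpace.toTopologicalSpace = t →
    ∀ ε : ℝ, 0 < ε → ∃ (A : Type) (_ : Finite A) (_ : TopologicalSpace A)
      (_ : DiscreteTopology A) (K : TopGraph A) (f : V → A),
      K.Connected ∧ G.IsConfluentEpi K f ∧ IsEpsMap m ε f

/-- A continuum: a (nonempty) compact connected metrizable space. -/
def IsContinuum (X : Type u) [TopologicalSpace X] : Prop :=
  CompactSpace X ∧ ConnectedSpace X ∧ TopologicalSpace.MetrizableSpace X

def IsHomogeneousSpace (X : Type u) [TopologicalSpace X] : Prop :=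
  ∀ x y : X, ∃ h : X ≃ₜ X, h x = y

/-! Existence. Between finite connected graphs, confluence amounts to lifting edges to walks
(`LiftsEdges`). With this, a component of the fibre product of two confluent epimorphisms projects
confluently to both factors (`exists_amalgam`). So an inverse sequence can be built that solves
every extension problem, and compactness carries confluence and the solutions over to its limit.

Transitivity. In the subdivision of a graph, a half-edge is adjacent to only one vertex lying over a
different vertex of the graph. Lifting a fine finite quotient to its subdivision therefore excludes
a path `a`, `b`, `c` of edges whose ends are not adjacent (`edge_trans`). The realization is then a
closed quotient of a compact metrizable space, and is connected because the finite quotients are.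

Non-homogeneity. `IsRecurrentPoint` is a topological property that holds at some point and fails at
another.

It holds somewhere: a map onto the four-cycle cuts the realization cyclically into `P` and `Q`, and
confluence makes every nonempty relatively clopen part of a piece meet the adjacent cuts. If no
point of `N` were recurrent, finitely many forward pairs would witness this on all of `N`.
Travelling through `Q` to `N` keeps the set of pairs whose `R` contains the current point; crossing
`N` and travelling through `P` to `M` strictly enlarges it. This cannot go on forever
(`IsCyclicCut.exists_isRecurrentPoint`).

It fails somewhere: by Baire there is a vertex `y` for which extensions may send `y` to any
admissible vertex (`exists_isGenericVertex`). For a cyclic cut with `y` over `N`, two copies of a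
finite quotient are joined by extra vertices over `N` leading one way, from the first copy to the
second (`twoSheet`). Sending `y` to such an extra vertex yields a forward pair that contains the
point in `S` but not in `R`. -/

open Set Relation Topology

/-! ### Connected sets, components and confluent maps. -/

namespace TopGraph

variable {V : Type*} [TopologicalSpace V] {W : Type*} [TopologicalSpace W]
  {X : Type*} [TopologicalSpace X]

/-- A subset of a connected set which is relatively clopen, nonempty and closed under edges is
everything. -/
theorem ConnectedSet.subset_of_closed {G : TopGraph V} {S U : Set V} (hS : G.ConnectedSet S)
    (hU : IsClosed ((↑) ⁻¹' U : Set S)) (hU' : IsOpen ((↑) ⁻¹' U : Set S))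
    (hE : ∀ a ∈ S ∩ U, ∀ b ∈ S, G.Edge a b → b ∈ U) (hne : (S ∩ U).Nonempty) : S ⊆ U := by
  by_contra hcon
  obtain ⟨x, hxS, hxU⟩ := not_subset.1 hcon
  refine hS ⟨S ∩ U, S \ U, hne, ⟨x, hxS, hxU⟩, ?_, ?_, inter_union_sdiff S U, ?_⟩
  · convert hU using 1
    ext y
    simp
  · convert hU'.isClosed_compl using 1
    ext y
    simp
  · exact fun a ha b hb hab => hb.2 (hE a ha b hb.1 hab)

theorem ConnectedSet.image {G : TopGraph V} {H : TopGraph W} {f : V → W} (hf : Continuous f)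
    (hE : ∀ a b, G.Edge a b → H.Edge (f a) (f b)) {S : Set V} (hS : G.ConnectedSet S) :
    H.ConnectedSet (f '' S) := by
  rintro ⟨P, Q, ⟨p, hp⟩, ⟨q, hq⟩, hPc, hQc, hPQ, hne⟩
  have key : ∀ R : Set W, IsClosed ((↑) ⁻¹' R : Set (f '' S)) →
      IsClosed ((↑) ⁻¹' (S ∩ f ⁻¹' R) : Set S) := by
    intro R hR
    have : Continuous (fun x : S => (⟨f x, mem_image_of_mem f x.2⟩ : f '' S)) := by fun_prop
    convert hR.preimage this using 1
    ext x
    simp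
  have hp' : p ∈ f '' S := hPQ ▸ Or.inl hp
  have hq' : q ∈ f '' S := hPQ ▸ Or.inr hq
  obtain ⟨a, ha, rfl⟩ := hp'
  obtain ⟨b, hb, rfl⟩ := hq'
  refine hS ⟨S ∩ f ⁻¹' P, S ∩ f ⁻¹' Q, ⟨a, ha, hp⟩, ⟨b, hb, hq⟩, key P hPc, key Q hQc, ?_, ?_⟩
  · ext x
    constructor
    · rintro (h | h) <;> exact h.1
    · intro hx
      have : f x ∈ P ∪ Q := hPQ ▸ mem_image_of_mem f hx
      exact this.imp (fun h => ⟨hx, h⟩) (fun h => ⟨hx, h⟩)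
  · exact fun x hx y hy hxy => hne _ hx.2 _ hy.2 (hE _ _ hxy)

theorem connectedSet_singleton (G : TopGraph V) (a : V) : G.ConnectedSet {a} := by
  rintro ⟨P, Q, ⟨p, hp⟩, ⟨q, hq⟩, -, -, hPQ, hne⟩
  have h1 : p = a := by simpa using hPQ.subset (Or.inl hp)
  have h2 : q = a := by simpa using hPQ.subset (Or.inr hq)
  subst h1
  subst h2
  exact hne _ hp _ hq (G.refl _)

theorem ConnectedSet.sUnion {G : TopGraph V} {𝒮 : Set (Set V)} {a : V}
    (h : ∀ S ∈ 𝒮, a ∈ S ∧ G.ConnectedSet S) : G.ConnectedSet (⋃₀ 𝒮) := by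
  rintro ⟨P, Q, ⟨p, hp⟩, ⟨q, hq⟩, hPc, hQc, hPQ, hne⟩
  wlog haP : a ∈ P generalizing P Q p q
  · obtain ⟨S, hS, -⟩ : p ∈ ⋃₀ 𝒮 := hPQ ▸ Or.inl hp
    have haQ : a ∈ P ∪ Q := hPQ ▸ ⟨S, hS, (h S hS).1⟩
    exact this Q P q hq p hp hQc hPc (union_comm Q P ▸ hPQ)
      (fun x hx y hy hxy => hne y hy x hx (G.symm _ _ hxy)) (haQ.resolve_left haP)
  obtain ⟨S, hS, hqS⟩ : q ∈ ⋃₀ 𝒮 := hPQ ▸ Or.inr hq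
  have key : ∀ R : Set V, IsClosed ((↑) ⁻¹' R : Set (⋃₀ 𝒮)) →
      IsClosed ((↑) ⁻¹' (S ∩ R) : Set S) := by
    intro R hR
    have : Continuous (fun x : S => (⟨x, S, hS, x.2⟩ : ⋃₀ 𝒮)) := by fun_prop
    convert hR.preimage this using 1
    ext x
    simp
  refine (h S hS).2 ⟨S ∩ P, S ∩ Q, ⟨a, (h S hS).1, haP⟩, ⟨q, hqS, hq⟩, key P hPc, key Q hQc, ?_, ?_⟩
  · rw [← inter_union_distrib_left, hPQ, inter_eq_left]
    exact subset_sUnion_of_mem hS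
  · exact fun x hx y hy hxy => hne _ hx.2 _ hy.2 hxy

theorem connectedSet_component (G : TopGraph V) (S : Set V) (a : V) :
    G.ConnectedSet (G.component S a) :=
  ConnectedSet.sUnion (a := a) fun _ hP => hP.2

theorem component_subset (G : TopGraph V) (S : Set V) (a : V) : G.component S a ⊆ S :=
  sUnion_subset fun _ hP => hP.1

theorem mem_component_self (G : TopGraph V) {S : Set V} {a : V} (ha : a ∈ S) :
    a ∈ G.component S a :=
  ⟨{a}, ⟨by simpa, rfl, G.connectedSet_singleton a⟩, rfl⟩

theorem ConnectedSet.subset_component {G : TopGraph V} {P S : Set V} {a : V}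
    (hP : G.ConnectedSet P) (hPS : P ⊆ S) (ha : a ∈ P) : P ⊆ G.component S a :=
  subset_sUnion_of_mem ⟨hPS, ha, hP⟩

/-- To check confluence it suffices to find connected sets with large images. -/
theorem image_component_eq {Y : Type*} {G : TopGraph V} {f : V → Y} {Q : Set Y} {a : V} {C : Set V}
    (hC : G.ConnectedSet C) (haC : a ∈ C) (hCQ : C ⊆ f ⁻¹' Q) (hQC : Q ⊆ f '' C) :
    f '' G.component (f ⁻¹' Q) a = Q :=
  Subset.antisymm (image_subset_iff.2 (component_subset _ _ _))
    (hQC.trans (image_mono (hC.subset_component hCQ haC)))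

theorem IsEpi.comp {G : TopGraph V} {H : TopGraph W} {K : TopGraph X} {f : V → W} {g : W → X}
    (hg : H.IsEpi K g) (hf : G.IsEpi H f) : G.IsEpi K (g ∘ f) where
  continuous := hg.continuous.comp hf.continuous
  map_edge a b h := hg.map_edge _ _ (hf.map_edge _ _ h)
  surjective := hg.surjective.comp hf.surjective
  surjective_edge c d h := by
    obtain ⟨a, b, hab, rfl, rfl⟩ := hg.surjective_edge c d h
    obtain ⟨a', b', hab', rfl, rfl⟩ := hf.surjective_edge a b hab
    exact ⟨a', b', hab', rfl, rfl⟩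

theorem IsConfluentEpi.comp {G : TopGraph V} {H : TopGraph W} {K : TopGraph X} {f : V → W}
    {g : W → X} (hg : H.IsConfluentEpi K g) (hf : G.IsConfluentEpi H f) :
    G.IsConfluentEpi K (g ∘ f) where
  toIsEpi := hg.toIsEpi.comp hf.toIsEpi
  confluent Q hQ a ha := by
    have h1 := hg.confluent Q hQ (f a) ha
    have h2 := hf.confluent _ (H.connectedSet_component (g ⁻¹' Q) (f a)) a
      (H.mem_component_self ha)
    refine image_component_eq (G.connectedSet_component _ a)
      (G.mem_component_self (S := f ⁻¹' H.component (g ⁻¹' Q) (f a)) (H.mem_component_self ha)) ?_ ?_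
    · exact (component_subset _ _ _).trans (preimage_mono (component_subset _ _ _))
    · rw [image_comp, h2, h1]

/-- The image under `f` of a component upstairs is a connected set that `g` already maps onto `Q`.
This makes a confluent map confluent again after factoring it through a finite quotient. -/
theorem IsConfluentEpi.of_comp {G : TopGraph V} {H : TopGraph W} {K : TopGraph X} {f : V → W}
    {g : W → X} (hg : Continuous g) (hgf : G.IsConfluentEpi K (g ∘ f)) (hf : G.IsEpi H f) :
    H.IsConfluentEpi K g where
  continuous := hg
  map_edge c d h := by
    obtain ⟨a, b, hab, rfl, rfl⟩ := hf.surjective_edge c d h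
    exact hgf.map_edge a b hab
  surjective := hgf.surjective.of_comp
  surjective_edge c d h := by
    obtain ⟨a, b, hab, rfl, rfl⟩ := hgf.surjective_edge c d h
    exact ⟨f a, f b, hf.map_edge _ _ hab, rfl, rfl⟩
  confluent Q hQ b hb := by
    obtain ⟨a, rfl⟩ := hf.surjective b
    have h := hgf.confluent Q hQ a hb
    refine image_component_eq
      ((G.connectedSet_component ((g ∘ f) ⁻¹' Q) a).image hf.continuous hf.map_edge)
      (mem_image_of_mem f (G.mem_component_self hb)) ?_ ?_
    · exact image_subset_iff.2 (component_subset _ _ _)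
    · rw [← image_comp, h]

/-! ### Walks and confluence in discrete graphs. -/

/-- `b` can be reached from `a` by a walk in `S`. -/
def Reach (G : TopGraph V) (S : Set V) : V → V → Prop :=
  ReflTransGen fun a b => G.Edge a b ∧ b ∈ S

theorem Reach.mono {G : TopGraph V} {S T : Set V} (h : S ⊆ T) {a b : V} (hab : G.Reach S a b) :
    G.Reach T a b :=
  ReflTransGen.mono (fun _ _ h' => ⟨h'.1, h h'.2⟩) _ _ hab

theorem Reach.mem {G : TopGraph V} {S : Set V} {a b : V} (hab : G.Reach S a b) (ha : a ∈ S) :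
    b ∈ S := by
  induction hab with
  | refl => exact ha
  | tail _ h _ => exact h.2

theorem Reach.symm {G : TopGraph V} {S : Set V} {a b : V} (hab : G.Reach S a b) (ha : a ∈ S) :
    G.Reach S b a := by
  induction hab with
  | refl => exact ReflTransGen.refl
  | tail h1 h ih => exact ReflTransGen.head ⟨G.symm _ _ h.1, Reach.mem h1 ha⟩ ih

theorem Reach.map {G : TopGraph V} {H : TopGraph W} {f : V → W}
    (hf : ∀ a b, G.Edge a b → H.Edge (f a) (f b)) {S : Set V} {T : Set W} (hST : ∀ a ∈ S, f a ∈ T)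
    {a b : V} (hab : G.Reach S a b) : H.Reach T (f a) (f b) :=
  ReflTransGen.lift f (fun _ _ h => ⟨hf _ _ h.1, hST _ h.2⟩) _ _ hab

/-- In a discrete graph connectedness is reachability. -/
theorem connectedSet_iff_reach [DiscreteTopology V] (G : TopGraph V) (S : Set V) :
    G.ConnectedSet S ↔ ∀ a ∈ S, ∀ b ∈ S, G.Reach S a b := by
  constructor
  · intro hS a ha b hb
    exact hS.subset_of_closed (U := {v | G.Reach S a v}) (isClosed_discrete _) (isOpen_discrete _)
      (fun x hx y hy hxy => ReflTransGen.tail hx.2 ⟨hxy, hy⟩) ⟨a, ha, ReflTransGen.refl⟩ hb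
  · rintro h ⟨P, Q, ⟨p, hp⟩, ⟨q, hq⟩, -, -, rfl, hne⟩
    have key : ∀ x, G.Reach (P ∪ Q) p x → x ∈ P := by
      intro x hx
      induction hx with
      | refl => exact hp
      | tail h1 h2 ih => exact h2.2.resolve_right fun hQ => hne _ ih _ hQ h2.1
    exact hne _ (key q (h p (Or.inl hp) q (Or.inr hq))) _ hq (G.refl q)

theorem connected_iff_reach [DiscreteTopology V] (G : TopGraph V) :
    G.Connected ↔ Nonempty V ∧ ∀ a b, G.Reach univ a b := by
  simp [Connected, connectedSet_iff_reach]

theorem reach_of_mem_component [DiscreteTopology V] {G : TopGraph V} {S : Set V} {a b : V}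
    (h : b ∈ G.component S a) : G.Reach S a b := by
  obtain ⟨P, ⟨hPS, haP, hP⟩, hb⟩ := h
  exact ((G.connectedSet_iff_reach P).1 hP a haP b hb).mono hPS

theorem mem_component_of_reach [DiscreteTopology V] {G : TopGraph V} {S : Set V} {a b : V}
    (ha : a ∈ S) (h : G.Reach S a b) : b ∈ G.component S a := by
  have hc : G.ConnectedSet {v | v ∈ S ∧ G.Reach S a v} := by
    rw [connectedSet_iff_reach]
    have key : ∀ v, G.Reach S a v → G.Reach {v | v ∈ S ∧ G.Reach S a v} a v := by
      intro v hv
      induction hv with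
      | refl => exact ReflTransGen.refl
      | tail h1 h2 ih => exact ih.tail ⟨h2.1, h2.2, ReflTransGen.tail h1 h2⟩
    exact fun x hx y hy => ((key x hx.2).symm ⟨ha, ReflTransGen.refl⟩).trans (key y hy.2)
  exact hc.subset_component (fun v hv => hv.1) ⟨ha, ReflTransGen.refl⟩ ⟨h.mem ha, h⟩

/-- The walk-lifting property, which characterizes confluent maps between finite graphs. -/
def LiftsEdges (G : TopGraph V) (H : TopGraph W) (f : V → W) : Prop :=
  ∀ a d, H.Edge (f a) d → ∃ b, G.Reach (f ⁻¹' {f a, d}) a b ∧ f b = d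

theorem connectedSet_pair [DiscreteTopology W] {H : TopGraph W} {c d : W} (h : H.Edge c d) :
    H.ConnectedSet {c, d} := by
  rw [connectedSet_iff_reach]
  rintro a (rfl | rfl) b (rfl | rfl)
  · exact ReflTransGen.refl
  · exact ReflTransGen.single ⟨h, Or.inr rfl⟩
  · exact ReflTransGen.single ⟨H.symm _ _ h, Or.inl rfl⟩
  · exact ReflTransGen.refl

theorem IsConfluentEpi.liftsEdges [DiscreteTopology V] [DiscreteTopology W] {G : TopGraph V}
    {H : TopGraph W} {f : V → W} (hf : G.IsConfluentEpi H f) : G.LiftsEdges H f := by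
  intro a d had
  have h := hf.confluent _ (connectedSet_pair had) a (Or.inl rfl)
  obtain ⟨b, hb, rfl⟩ : d ∈ f '' G.component (f ⁻¹' {f a, d}) a := h.symm.subset (Or.inr rfl)
  exact ⟨b, reach_of_mem_component hb, rfl⟩

theorem LiftsEdges.lift_reach {G : TopGraph V} {H : TopGraph W} {f : V → W}
    (hf : G.LiftsEdges H f) {Q : Set W} {a : V} (ha : f a ∈ Q) {d : W} (h : H.Reach Q (f a) d) :
    ∃ b, G.Reach (f ⁻¹' Q) a b ∧ f b = d := by
  induction h with
  | refl => exact ⟨a, ReflTransGen.refl, rfl⟩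
  | tail h1 h2 ih =>
    obtain ⟨b, hab, rfl⟩ := ih
    obtain ⟨c, hbc, rfl⟩ := hf b _ h2.1
    refine ⟨c, hab.trans (hbc.mono (preimage_mono ?_)), rfl⟩
    rintro x (rfl | rfl)
    · exact hab.mem (S := f ⁻¹' Q) ha
    · exact h2.2

/-- Walks lift step by step, which gives confluence and, as `H` is connected, surjectivity. A lifted
walk over an edge stays over its two ends, so it either crosses between the two fibres or the ends
coincide; this gives surjectivity on edges. -/
theorem isConfluentEpi_of_liftsEdges [DiscreteTopology V] [DiscreteTopology W] [Nonempty V]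
    {G : TopGraph V} {H : TopGraph W} {f : V → W} (hH : H.Connected)
    (hE : ∀ a b, G.Edge a b → H.Edge (f a) (f b)) (hf : G.LiftsEdges H f) :
    G.IsConfluentEpi H f := by
  have hs : Function.Surjective f := fun d => by
    obtain ⟨a⟩ := ‹Nonempty V›
    obtain ⟨b, -, hb⟩ := hf.lift_reach (mem_univ (f a)) (((connected_iff_reach H).1 hH).2 (f a) d)
    exact ⟨b, hb⟩
  refine { continuous := continuous_of_discreteTopology, map_edge := hE, surjective := hs,
           surjective_edge := ?_, confluent := ?_ }
  · intro c d hcd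
    obtain ⟨a, rfl⟩ := hs c
    obtain ⟨b, hab, rfl⟩ := hf a d hcd
    have key : ∀ x, G.Reach (f ⁻¹' {f a, f b}) a x → f x = f a ∨
        ∃ y z, G.Edge y z ∧ f y = f a ∧ f z = f b := by
      intro x hx
      induction hx with
      | refl => exact Or.inl rfl
      | tail h1 h2 ih =>
        refine ih.elim (fun h => ?_) Or.inr
        exact h2.2.imp id fun h' => ⟨_, _, h2.1, h, h'⟩
    rcases key b hab with h | h
    · exact ⟨a, a, G.refl a, rfl, h.symm⟩
    · exact h
  · intro Q hQ a ha
    refine Subset.antisymm (image_subset_iff.2 (component_subset _ _ _)) fun d hd => ?_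
    obtain ⟨b, hab, rfl⟩ := hf.lift_reach ha ((connectedSet_iff_reach H Q).1 hQ _ ha d hd)
    exact ⟨b, mem_component_of_reach ha hab, rfl⟩

/-! ### Amalgamation. -/

/-- The amalgam of two confluent epimorphisms of finite connected graphs, with a base point. -/
theorem exists_amalgam {A B C : Type} [TopologicalSpace A] [DiscreteTopology A]
    [TopologicalSpace B] [DiscreteTopology B] [Finite B]
    [TopologicalSpace C] [DiscreteTopology C] [Finite C]
    {K : TopGraph A} {L : TopGraph B} {M : TopGraph C} (hL : L.Connected) (hM : M.Connected)
    {f : B → A} {g : C → A} (hf : L.IsConfluentEpi K f) (hg : M.IsConfluentEpi K g)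
    {b : B} {c : C} (hbc : f b = g c) :
    ∃ (D : Type) (_ : Finite D) (_ : TopologicalSpace D) (_ : DiscreteTopology D)
      (N : TopGraph D) (p : D → B) (q : D → C) (d : D), N.Connected ∧ N.IsConfluentEpi L p ∧
      N.IsConfluentEpi M q ∧ f ∘ p = g ∘ q ∧ p d = b ∧ q d = c := by
  let r : B × C → B × C → Prop := fun x y =>
    (L.Edge x.1 y.1 ∧ M.Edge x.2 y.2) ∧ f y.1 = g y.2
  -- The component of `(b, c)` in the fibre product; passing to it makes the amalgam connected.
  let D : Type := {x : B × C // ReflTransGen r (b, c) x}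
  have hfg : ∀ x : D, f x.1.1 = g x.1.2 := by
    rintro ⟨x, hx⟩
    induction hx with
    | refl => exact hbc
    | tail _ h _ => exact h.2
  let N : TopGraph D :=
    { Edge := fun x y => L.Edge x.1.1 y.1.1 ∧ M.Edge x.1.2 y.1.2
      refl := fun x => ⟨L.refl _, M.refl _⟩
      symm := fun x y h => ⟨L.symm _ _ h.1, M.symm _ _ h.2⟩
      closed := isClosed_discrete _ }
  let d : D := ⟨(b, c), ReflTransGen.refl⟩
  have hN : N.Connected := by
    rw [connected_iff_reach]
    have key : ∀ x : D, N.Reach univ d x := by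
      rintro ⟨x, hx⟩
      induction hx with
      | refl => exact ReflTransGen.refl
      | tail h1 h ih => exact ReflTransGen.tail ih ⟨h.1, mem_univ _⟩
    exact ⟨⟨d⟩, fun x y => ((key x).symm (mem_univ _)).trans (key y)⟩
  have : Nonempty D := ⟨d⟩
  have hp : N.LiftsEdges L fun x => x.1.1 := by
    intro x b' hb'
    obtain ⟨c', hc', hfc'⟩ := hg.liftsEdges x.1.2 (f b') (hfg x ▸ hf.map_edge _ _ hb')
    by_cases hff : f b' = f x.1.1
    · exact ⟨⟨(b', x.1.2), x.2.tail ⟨⟨hb', M.refl _⟩, hff.trans (hfg x)⟩⟩,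
        ReflTransGen.single ⟨⟨hb', M.refl _⟩, Or.inr rfl⟩, rfl⟩
    -- While the second coordinate follows the lifted walk, the first one switches between `x.1.1`
    -- and `b'` so as to stay in the fibre product. At the end of the walk the images under `f`
    -- leave only `b'`.
    have key : ∀ z, M.Reach (g ⁻¹' {g x.1.2, f b'}) x.1.2 z →
        ∃ y : D, N.Reach ((fun x : D => x.1.1) ⁻¹' {x.1.1, b'}) x y ∧ y.1.2 = z ∧
          (y.1.1 = x.1.1 ∨ y.1.1 = b') := by
      intro z hz
      induction hz with
      | refl => exact ⟨x, ReflTransGen.refl, rfl, Or.inl rfl⟩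
      | @tail z w h1 h2 ih =>
        obtain ⟨y, hxy, rfl, hy⟩ := ih
        have hstep : ∀ e : B, e = x.1.1 ∨ e = b' → f e = g w →
            ∃ y' : D, N.Reach ((fun x : D => x.1.1) ⁻¹' {x.1.1, b'}) x y' ∧ y'.1.2 = w ∧
              (y'.1.1 = x.1.1 ∨ y'.1.1 = b') := by
          intro e he hew
          have hE : L.Edge y.1.1 e := by
            rcases hy with hy | hy <;> rcases he with rfl | rfl <;> rw [hy]
            exacts [L.refl _, hb', L.symm _ _ hb', L.refl _]
          exact ⟨⟨(e, w), y.2.tail ⟨⟨hE, h2.1⟩, hew⟩⟩, hxy.tail ⟨⟨hE, h2.1⟩, he⟩, rfl, he⟩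
        rcases h2.2 with h | h
        · exact hstep x.1.1 (Or.inl rfl) ((hfg x).trans h.symm)
        · exact hstep b' (Or.inr rfl) h.symm
    obtain ⟨y, hxy, hyc, hy⟩ := key c' hc'
    refine ⟨y, hxy, hy.resolve_left fun h => hff ?_⟩
    rw [← hfc', ← hyc, ← hfg y, h]
  have hq : N.LiftsEdges M fun x => x.1.2 := by
    intro x c' hc'
    obtain ⟨b', hb', hfb'⟩ := hf.liftsEdges x.1.1 (g c') ((hfg x).symm ▸ hg.map_edge _ _ hc')
    by_cases hff : g c' = g x.1.2
    · exact ⟨⟨(x.1.1, c'), x.2.tail ⟨⟨L.refl _, hc'⟩, (hfg x).trans hff.symm⟩⟩,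
        ReflTransGen.single ⟨⟨L.refl _, hc'⟩, Or.inr rfl⟩, rfl⟩
    have key : ∀ z, L.Reach (f ⁻¹' {f x.1.1, g c'}) x.1.1 z →
        ∃ y : D, N.Reach ((fun x : D => x.1.2) ⁻¹' {x.1.2, c'}) x y ∧ y.1.1 = z ∧
          (y.1.2 = x.1.2 ∨ y.1.2 = c') := by
      intro z hz
      induction hz with
      | refl => exact ⟨x, ReflTransGen.refl, rfl, Or.inl rfl⟩
      | @tail z w h1 h2 ih =>
        obtain ⟨y, hxy, rfl, hy⟩ := ih
        have hstep : ∀ e : C, e = x.1.2 ∨ e = c' → f w = g e →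
            ∃ y' : D, N.Reach ((fun x : D => x.1.2) ⁻¹' {x.1.2, c'}) x y' ∧ y'.1.1 = w ∧
              (y'.1.2 = x.1.2 ∨ y'.1.2 = c') := by
          intro e he hew
          have hE : M.Edge y.1.2 e := by
            rcases hy with hy | hy <;> rcases he with rfl | rfl <;> rw [hy]
            exacts [M.refl _, hc', M.symm _ _ hc', M.refl _]
          exact ⟨⟨(w, e), y.2.tail ⟨⟨h2.1, hE⟩, hew⟩⟩, hxy.tail ⟨⟨h2.1, hE⟩, he⟩, rfl, he⟩
        rcases h2.2 with h | h
        · exact hstep x.1.2 (Or.inl rfl) (h.trans (hfg x))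
        · exact hstep c' (Or.inr rfl) h
    obtain ⟨y, hxy, hyc, hy⟩ := key b' hb'
    refine ⟨y, hxy, hy.resolve_left fun h => hff ?_⟩
    rw [← hfb', ← hyc, hfg y, h]
  exact ⟨D, inferInstance, inferInstance, inferInstance, N, _, _, d, hN,
    isConfluentEpi_of_liftsEdges hL (fun _ _ h => h.1) hp,
    isConfluentEpi_of_liftsEdges hM (fun _ _ h => h.2) hq, funext hfg, rfl, rfl⟩

end TopGraph

/-! ### Closed quotients of compact spaces. -/

/-- Preimages of small sets under closed maps. -/
theorem IsClosedMap.isOpen_kernImage' {X Y : Type*} [TopologicalSpace X] [TopologicalSpace Y]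
    {f : X → Y} (hf : IsClosedMap f) {U : Set X} (hU : IsOpen U) : IsOpen {y | f ⁻¹' {y} ⊆ U} := by
  have : {y | f ⁻¹' {y} ⊆ U} = (f '' Uᶜ)ᶜ := by
    ext y
    simp only [mem_ofPred_eq, mem_compl_iff, mem_image, not_exists, not_and, subset_def,
      mem_preimage, mem_singleton_iff]
    exact ⟨fun h x hx hxy => hx (h x hxy), fun h x hxy => by_contra fun hx => h x hx hxy⟩
  rw [this]
  exact (hf _ hU.isClosed_compl).isOpen_compl

/-- The image of a compact second countable space under a closed map is second countable. -/
theorem IsClosedMap.secondCountableTopology {X Y : Type*} [TopologicalSpace X] [CompactSpace X]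
    [SecondCountableTopology X] [TopologicalSpace Y] [T1Space Y] {f : X → Y} (hf : IsClosedMap f)
    (hc : Continuous f) (hs : Function.Surjective f) : SecondCountableTopology Y := by
  let B := TopologicalSpace.countableBasis X
  have hB : TopologicalSpace.IsTopologicalBasis B := TopologicalSpace.isBasis_countableBasis X
  have hBc : B.Countable := TopologicalSpace.countable_countableBasis X
  let F : Set (Set (Set X)) := {s | s.Finite ∧ s ⊆ B}
  have hF : F.Countable := countable_ofPred_finite_subset hBc
  have hbasis : TopologicalSpace.IsTopologicalBasis
      ((fun s : Set (Set X) => {y | f ⁻¹' {y} ⊆ ⋃₀ s}) '' F) := by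
    refine TopologicalSpace.isTopologicalBasis_of_isOpen_of_nhds ?_ ?_
    · rintro _ ⟨s, hs, rfl⟩
      exact hf.isOpen_kernImage' (isOpen_sUnion fun t ht => hB.isOpen (hs.2 ht))
    · intro y W hy hW
      have hcomp : IsCompact (f ⁻¹' {y}) := (isClosed_singleton.preimage hc).isCompact
      have hcov : ∀ x ∈ f ⁻¹' {y}, ∃ t ∈ B, x ∈ t ∧ t ⊆ f ⁻¹' W := by
        intro x hx
        exact hB.exists_subset_of_mem_open (show f x ∈ W from hx ▸ hy) (hW.preimage hc)
      choose! t htB hxt htW using hcov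
      obtain ⟨s, hs2⟩ := hcomp.elim_nhds_subcover' (fun x _ => t x)
        fun x hx => (hB.isOpen (htB x hx)).mem_nhds (hxt x hx)
      refine ⟨_, ⟨(fun x : f ⁻¹' {y} => t x) '' s, ⟨s.finite_toSet.image _, ?_⟩, rfl⟩, ?_, ?_⟩
      · rintro _ ⟨x, -, rfl⟩
        exact htB x x.2
      · intro x hx
        obtain ⟨z, hz, hxz⟩ := mem_iUnion₂.1 (hs2 hx)
        exact ⟨_, ⟨z, hz, rfl⟩, hxz⟩
      · intro z hz
        obtain ⟨x, rfl⟩ := hs z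
        obtain ⟨_, ⟨w, -, rfl⟩, hxw⟩ := hz (mem_singleton (f x))
        exact htW w w.2 hxw
  exact hbasis.secondCountableTopology (hF.image _)

/-- A closed image of a compact Hausdorff space is Hausdorff. -/
theorem IsClosedMap.t2Space {X Y : Type*} [TopologicalSpace X] [CompactSpace X] [T2Space X]
    [TopologicalSpace Y] {f : X → Y} (hf : IsClosedMap f) (hc : Continuous f)
    (hs : Function.Surjective f) : T2Space Y := by
  have hpt : ∀ y : Y, IsClosed ({y} : Set Y) := fun y => by
    obtain ⟨x, rfl⟩ := hs y
    simpa using hf _ (isClosed_singleton (x := x))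
  refine ⟨fun y z hyz => ?_⟩
  have hd : Disjoint (f ⁻¹' {y}) (f ⁻¹' {z}) :=
    Disjoint.preimage f (by simpa using hyz)
  obtain ⟨U, W, hU, hW, hyU, hzW, hUW⟩ := SeparatedNhds.of_isCompact_isCompact
    ((hpt y).preimage hc).isCompact ((hpt z).preimage hc).isCompact hd
  refine ⟨_, _, hf.isOpen_kernImage' hU, hf.isOpen_kernImage' hW, hyU, hzW, ?_⟩
  rw [disjoint_left]
  intro w hw1 hw2
  obtain ⟨x, rfl⟩ := hs w
  exact disjoint_left.1 hUW (hw1 rfl) (hw2 rfl)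

/-! ### The realization and the subdivision of a graph. -/

namespace TopGraph

variable {V : Type*} [TopologicalSpace V]

/-- The quotient map onto the topological realization. -/
def toRealization (G : TopGraph V) (a : V) : G.Realization := Quot.mk _ a

theorem continuous_toRealization (G : TopGraph V) : Continuous G.toRealization :=
  continuous_quot_mk

theorem surjective_toRealization (G : TopGraph V) : Function.Surjective G.toRealization :=
  Quot.mk_surjective

theorem toRealization_eq_iff {G : TopGraph V}
    (hG : ∀ a b c : V, G.Edge a b → G.Edge b c → G.Edge a c) {a b : V} :
    G.toRealization a = G.toRealization b ↔ G.Edge a b := by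
  have he : Equivalence G.Edge := ⟨G.refl, fun h => G.symm _ _ h, fun h h' => hG _ _ _ h h'⟩
  exact Quot.eq.trans he.eqvGen_iff

/-- The saturation of a closed set is the projection of a closed subset of `V × V` along a compact
factor. -/
theorem isClosedMap_toRealization {G : TopGraph V} [CompactSpace V]
    (hG : ∀ a b c : V, G.Edge a b → G.Edge b c → G.Edge a c) : IsClosedMap G.toRealization := by
  intro C hC
  have hq : IsQuotientMap G.toRealization := isQuotientMap_quot_mk
  rw [← hq.isClosed_preimage]
  have : G.toRealization ⁻¹' (G.toRealization '' C) =
      Prod.snd '' ({p : V × V | G.Edge p.1 p.2} ∩ Prod.fst ⁻¹' C) := by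
    ext x
    constructor
    · rintro ⟨y, hy, hxy⟩
      exact ⟨(y, x), ⟨(toRealization_eq_iff hG).1 hxy, hy⟩, rfl⟩
    · rintro ⟨⟨y, z⟩, ⟨hyz, hy⟩, rfl⟩
      exact ⟨y, hy, (toRealization_eq_iff hG).2 hyz⟩
  rw [this]
  exact isClosedMap_snd_of_compactSpace _ (G.closed.inter (hC.preimage continuous_fst))

/-- The subdivision of a graph: the vertex `(v, v)` is the vertex `v`, and the vertex `(v, w)` is
the half of the edge between `v` and `w` that is adjacent to `v`. -/
def subdivision {A : Type*} [TopologicalSpace A] [DiscreteTopology A] (K : TopGraph A) :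
    TopGraph {p : A × A // K.Edge p.1 p.2} where
  Edge p q := p = q ∨ (p.1.1 = q.1.1 ∧ (p.1.1 = p.1.2 ∨ q.1.1 = q.1.2)) ∨
    (p.1.1 = q.1.2 ∧ p.1.2 = q.1.1)
  refl p := Or.inl rfl
  symm p q := by
    rintro (h | ⟨h, h'⟩ | ⟨h, h'⟩)
    · exact Or.inl h.symm
    · exact Or.inr (Or.inl ⟨h.symm, h'.symm⟩)
    · exact Or.inr (Or.inr ⟨h'.symm, h.symm⟩)
  closed := isClosed_discrete _

theorem subdivision_spec {A : Type*} [TopologicalSpace A] [DiscreteTopology A] {K : TopGraph A}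
    (hK : K.Connected) : K.subdivision.Connected ∧ K.subdivision.IsConfluentEpi K fun p => p.1.1 := by
  have hl : K.subdivision.LiftsEdges K fun p => p.1.1 := by
    rintro ⟨⟨v, w⟩, hvw⟩ d (hd : K.Edge v d)
    refine ⟨⟨(d, v), K.symm _ _ hd⟩, ?_, rfl⟩
    -- The walk `(v, w)`, `(v, v)`, `(v, d)`, `(d, v)`: back to the vertex, then along the edge to
    -- `d`.
    refine ReflTransGen.tail (ReflTransGen.tail (ReflTransGen.single (b := ⟨(v, v), K.refl v⟩)
      ⟨Or.inr (Or.inl ⟨rfl, Or.inr rfl⟩), Or.inl rfl⟩) (c := ⟨(v, d), hd⟩)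
      ⟨Or.inr (Or.inl ⟨rfl, Or.inl rfl⟩), Or.inl rfl⟩) ⟨Or.inr (Or.inr ⟨rfl, rfl⟩), Or.inr rfl⟩
  have hc : K.subdivision.Connected := by
    have hK' := (connected_iff_reach K).1 hK
    rw [connected_iff_reach]
    obtain ⟨a⟩ := hK'.1
    have key : ∀ p, K.subdivision.Reach univ ⟨(a, a), K.refl a⟩ p := by
      rintro ⟨⟨v, w⟩, hvw⟩
      obtain ⟨⟨⟨v', w'⟩, h'⟩, hr, hv : v' = v⟩ :=
        hl.lift_reach (a := ⟨(a, a), K.refl a⟩) (mem_univ _) (hK'.2 a v)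
      subst hv
      refine ReflTransGen.tail (hr.tail (c := ⟨(v', v'), K.refl v'⟩)
        ⟨Or.inr (Or.inl ⟨rfl, Or.inr rfl⟩), mem_univ _⟩)
        ⟨Or.inr (Or.inl ⟨rfl, Or.inl rfl⟩), mem_univ _⟩
    exact ⟨⟨⟨(a, a), K.refl a⟩⟩, fun x y => ((key x).symm (mem_univ _)).trans (key y)⟩
  have := hc.1
  refine ⟨hc, isConfluentEpi_of_liftsEdges hK ?_ hl⟩
  rintro ⟨⟨v, w⟩, hvw⟩ ⟨⟨v', w'⟩, hvw'⟩ (h | ⟨h, -⟩ | ⟨h, h'⟩)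
  · cases h
    exact K.refl _
  · simp only at h
    subst h
    exact K.refl _
  · simp only at h h'
    subst h h'
    exact hvw

end TopGraph

/-! ### Transitivity of the edge relation, and the realization as a continuum. -/

namespace IsConfluentFraisseLimit

open TopGraph

variable {V : Type*} [t : TopologicalSpace V] {G : TopGraph V}

/-- A limit maps onto finite connected graphs with fibres finer than a given open cover. -/
theorem exists_fibres_subset (hG : IsConfluentFraisseLimit G) {ι : Type*} {U : ι → Set V}
    (hU : ∀ i, IsOpen (U i)) (hcov : ∀ x, ∃ i, x ∈ U i) :
    ∃ (A : Type) (_ : Finite A) (_ : TopologicalSpace A) (_ : DiscreteTopology A) (K : TopGraph A)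
      (f : V → A), K.Connected ∧ G.IsConfluentEpi K f ∧ ∀ x, ∃ i, f ⁻¹' {f x} ⊆ U i := by
  have := hG.compactSpace
  have := hG.t2Space
  have := hG.secondCountableTopology
  let m : MetricSpace V := TopologicalSpace.metrizableSpaceMetric V
  obtain ⟨δ, hδ, hball⟩ := lebesgue_number_lemma_of_metric (isCompact_univ (X := V)) hU
    fun x _ => mem_iUnion.2 (hcov x)
  obtain ⟨A, i1, i2, i3, K, f, hK, hf, hε⟩ := hG.approximation m rfl δ hδ
  refine ⟨A, i1, i2, i3, K, f, hK, hf, fun x => ?_⟩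
  obtain ⟨i, hi⟩ := hball x (mem_univ x)
  refine ⟨i, Subset.trans (fun y hy => ?_) hi⟩
  have hb : Bornology.IsBounded (f ⁻¹' {f x}) := (isCompact_univ (X := V)).isBounded.subset (subset_univ _)
  exact (Metric.dist_le_diam_of_mem hb hy rfl).trans_lt (hε _)

theorem nonempty (hG : IsConfluentFraisseLimit G) : Nonempty V := by
  obtain ⟨A, i1, i2, i3, K, f, hK, hf, -⟩ := hG.exists_fibres_subset (U := fun _ : Unit => univ)
    (fun _ => isOpen_univ) fun x => ⟨(), mem_univ x⟩
  obtain ⟨a⟩ := hK.1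
  exact ⟨(hf.surjective a).choose⟩

theorem edge_trans (hG : IsConfluentFraisseLimit G) (a b c : V) (hab : G.Edge a b)
    (hbc : G.Edge b c) : G.Edge a c := by
  by_contra hac
  have := hG.t2Space
  obtain ⟨U, W, hU, hW, haU, hcW, hUW⟩ := isOpen_prod_iff.1 G.closed.isOpen_compl a c hac
  -- A member of this cover that contains `a` lies in `U`, and one that contains `c` lies in `W`.
  obtain ⟨A, i1, i2, i3, K, f, hK, hf, hfib⟩ := hG.exists_fibres_subset
    (U := fun i : Bool × Bool => (if i.1 then U else {a}ᶜ) ∩ (if i.2 then W else {c}ᶜ)) (by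
      rintro ⟨i, j⟩
      refine IsOpen.inter ?_ ?_
      · cases i
        · simp
        · simpa using hU
      · cases j
        · simp
        · simpa using hW) (by
      intro x
      by_cases h1 : x = a <;> by_cases h2 : x = c
      · exact ⟨(true, true), by subst h1; exact ⟨haU, h2 ▸ hcW⟩⟩
      · exact ⟨(true, false), by subst h1; exact ⟨haU, h2⟩⟩
      · exact ⟨(false, true), ⟨h1, h2 ▸ hcW⟩⟩
      · exact ⟨(false, false), ⟨h1, h2⟩⟩)
  have hfU : f ⁻¹' {f a} ⊆ U := by
    obtain ⟨⟨i, j⟩, hij⟩ := hfib a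
    cases i
    · exact absurd rfl (hij (show a ∈ f ⁻¹' {f a} from rfl)).1
    · exact hij.trans inter_subset_left
  have hfW : f ⁻¹' {f c} ⊆ W := by
    obtain ⟨⟨i, j⟩, hij⟩ := hfib c
    cases j
    · exact absurd rfl (hij (show c ∈ f ⁻¹' {f c} from rfl)).2
    · exact hij.trans inter_subset_right
  have hnot : ¬ K.Edge (f a) (f c) := fun h => by
    obtain ⟨x, y, hxy, hx, hy⟩ := hf.surjective_edge _ _ h
    exact hUW (mk_mem_prod (hfU hx) (hfW hy)) hxy
  have hab' : f a ≠ f b := fun h => hnot (h ▸ hf.map_edge _ _ hbc)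
  have hbc' : f b ≠ f c := fun h => hnot (h ▸ hf.map_edge _ _ hab)
  have hac' : f a ≠ f c := fun h => hnot (h ▸ K.refl _)
  obtain ⟨hc, hg⟩ := subdivision_spec hK
  obtain ⟨h, hh, rfl⟩ := hG.extension A _ K K.subdivision hK hc f _ hf hg
  -- An edge of the subdivision between different fibres joins the two halves of one edge. So the
  -- second coordinate of `h b` is the image of `a` as well as that of `c`.
  have key : ∀ x y, G.Edge x y → (h x).1.1 ≠ (h y).1.1 → (h x).1.2 = (h y).1.1 ∧
      (h x).1.1 = (h y).1.2 := by
    intro x y hxy hne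
    rcases hh.map_edge _ _ hxy with h' | h' | h'
    · exact absurd (congrArg (fun p => p.1.1) h') hne
    · exact absurd h'.1 hne
    · exact ⟨h'.2, h'.1⟩
  exact hac' ((key a b hab hab').2.trans (key b c hbc hbc').1)

theorem isContinuum_realization (hG : IsConfluentFraisseLimit G) : IsContinuum G.Realization := by
  have := hG.compactSpace
  have := hG.t2Space
  have := hG.secondCountableTopology
  have hcl := isClosedMap_toRealization hG.edge_trans
  have hT2 := hcl.t2Space G.continuous_toRealization G.surjective_toRealization
  have h2 := hcl.secondCountableTopology G.continuous_toRealization G.surjective_toRealization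
  have hcomp : CompactSpace G.Realization :=
    ⟨by rw [← G.surjective_toRealization.range_eq]; exact isCompact_range G.continuous_toRealization⟩
  obtain ⟨x0⟩ := hG.nonempty
  refine ⟨hcomp, ?_, inferInstance⟩
  have hpre : PreconnectedSpace G.Realization := by
    rw [preconnectedSpace_iff_clopen]
    intro s hs
    by_contra! hcon
    obtain ⟨h1, h2⟩ := hcon
    let S := G.toRealization ⁻¹' s
    have hS : IsClopen S := hs.preimage G.continuous_toRealization
    obtain ⟨A, i1, i2, i3, K, f, hK, hf, hfib⟩ := hG.exists_fibres_subset
      (U := fun i : Bool => if i then S else Sᶜ) (by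
        rintro (_ | _)
        · simpa using hS.isClosed
        · simpa using hS.isOpen) (by
        intro x
        by_cases h : x ∈ S
        · exact ⟨true, by simpa using h⟩
        · exact ⟨false, by simpa using h⟩)
    have hfS : ∀ x y, f x = f y → x ∈ S → y ∈ S := by
      intro x y hxy hx
      obtain ⟨i, hi⟩ := hfib x
      cases i
      · exact absurd hx (by simpa using hi (show x ∈ f ⁻¹' {f x} from rfl))
      · exact hi hxy.symm
    -- Adjacent vertices have the same image in the realization, so the saturated set `S` has an
    -- image closed under edges.
    have huniv := hK.2.subset_of_closed (U := f '' S) (isClosed_discrete _) (isOpen_discrete _) (by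
      rintro _ ⟨-, x, hx, rfl⟩ b - hb
      obtain ⟨y, z, hyz, hy, rfl⟩ := hf.surjective_edge _ _ hb
      refine mem_image_of_mem f ?_
      have hyS := hfS x y hy.symm hx
      have hyz' := (toRealization_eq_iff hG.edge_trans).2 hyz
      change G.toRealization z ∈ s
      rw [← hyz']
      exact hyS) (by
      obtain ⟨q, hq⟩ := h1
      obtain ⟨x, rfl⟩ := G.surjective_toRealization q
      exact ⟨f x, mem_univ _, x, hq, rfl⟩)
    refine h2 (eq_univ_of_forall fun q => ?_)
    obtain ⟨x, rfl⟩ := G.surjective_toRealization q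
    obtain ⟨y, hy, hyx⟩ := huniv (mem_univ (f x))
    exact hfS y x hyx hy
  exact { toPreconnectedSpace := hpre, toNonempty := ⟨G.toRealization x0⟩ }

end IsConfluentFraisseLimit

/-! ### Cyclic cuts and recurrent points. -/

/-- A space cut into two closed pieces `P` and `Q`, which meet in two disjoint closed sets `M` and
`N`, such that all relatively clopen subsets of the pieces meet `M`. We imagine a flow that runs
from `P` through `M` to `Q` and through `N` back to `P`. -/
structure IsCyclicCut {X : Type*} [TopologicalSpace X] (P Q M N : Set X) : Prop where
  closed_left : IsClosed P
  closed_right : IsClosed Q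
  closed_mid : IsClosed M
  closed_cut : IsClosed N
  union : P ∪ Q = univ
  inter : P ∩ Q = M ∪ N
  disjoint : Disjoint M N
  left_meets : ∀ S ⊆ P, IsClosed S → IsClosed (P \ S) → S.Nonempty → (S ∩ M).Nonempty
  right_meets : ∀ S ⊆ Q, IsClosed S → IsClosed (Q \ S) → S.Nonempty → (S ∩ M).Nonempty

/-- A pair of relatively clopen subsets of the pieces that the flow does not leave through `N`. -/
structure IsForwardPair {X : Type*} [TopologicalSpace X] (P Q M N S R : Set X) : Prop where
  left_subset : S ⊆ P
  closed_left : IsClosed S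
  closed_left' : IsClosed (P \ S)
  right_subset : R ⊆ Q
  closed_right : IsClosed R
  closed_right' : IsClosed (Q \ R)
  mid : S ∩ M = R ∩ M
  cut : R ∩ N ⊆ S

/-- A point on the cut `N` of some cyclic cut to which the flow returns. -/
def IsRecurrentPoint {X : Type*} [TopologicalSpace X] (x : X) : Prop :=
  ∃ P Q M N : Set X, IsCyclicCut P Q M N ∧ x ∈ N ∧
    ∀ S R, IsForwardPair P Q M N S R → x ∈ S → x ∈ R

theorem IsCyclicCut.preimage {X Y : Type*} [TopologicalSpace X] [TopologicalSpace Y] (h : X ≃ₜ Y)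
    {P Q M N : Set Y} (hc : IsCyclicCut P Q M N) :
    IsCyclicCut (h ⁻¹' P) (h ⁻¹' Q) (h ⁻¹' M) (h ⁻¹' N) where
  closed_left := hc.closed_left.preimage h.continuous
  closed_right := hc.closed_right.preimage h.continuous
  closed_mid := hc.closed_mid.preimage h.continuous
  closed_cut := hc.closed_cut.preimage h.continuous
  union := by rw [← preimage_union, hc.union, preimage_univ]
  inter := by rw [← preimage_inter, hc.inter, preimage_union]
  disjoint := hc.disjoint.preimage h
  left_meets S hS h1 h2 h3 := by
    obtain ⟨_, ⟨x, hx, rfl⟩, hx'⟩ := hc.left_meets (h '' S) (image_subset_iff.2 hS)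
      (h.isClosed_image.2 h1) (by
        rw [← h.image_preimage P, ← image_sdiff h.injective]
        exact h.isClosed_image.2 h2) (h3.image h)
    exact ⟨x, hx, hx'⟩
  right_meets S hS h1 h2 h3 := by
    obtain ⟨_, ⟨x, hx, rfl⟩, hx'⟩ := hc.right_meets (h '' S) (image_subset_iff.2 hS)
      (h.isClosed_image.2 h1) (by
        rw [← h.image_preimage Q, ← image_sdiff h.injective]
        exact h.isClosed_image.2 h2) (h3.image h)
    exact ⟨x, hx, hx'⟩

theorem IsForwardPair.preimage {X Y : Type*} [TopologicalSpace X] [TopologicalSpace Y] (h : X ≃ₜ Y)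
    {P Q M N S R : Set Y} (hc : IsForwardPair P Q M N S R) :
    IsForwardPair (h ⁻¹' P) (h ⁻¹' Q) (h ⁻¹' M) (h ⁻¹' N) (h ⁻¹' S) (h ⁻¹' R) where
  left_subset := preimage_mono hc.left_subset
  closed_left := hc.closed_left.preimage h.continuous
  closed_left' := hc.closed_left'.preimage h.continuous
  right_subset := preimage_mono hc.right_subset
  closed_right := hc.closed_right.preimage h.continuous
  closed_right' := hc.closed_right'.preimage h.continuous
  mid := by rw [← preimage_inter, hc.mid, preimage_inter]
  cut := preimage_mono hc.cut

theorem IsRecurrentPoint.of_homeomorph {X Y : Type*} [TopologicalSpace X] [TopologicalSpace Y]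
    (h : X ≃ₜ Y) {x : X} (hx : IsRecurrentPoint (h x)) : IsRecurrentPoint x := by
  obtain ⟨P, Q, M, N, hc, hxN, hrec⟩ := hx
  refine ⟨_, _, _, _, hc.preimage h, hxN, fun S R hSR hS => ?_⟩
  have := hSR.preimage h.symm
  simp only [← preimage_comp, h.self_comp_symm, preimage_id] at this
  simpa using hrec _ _ this (by simpa using hS)

/-- Finite Boolean combinations of relatively clopen sets are relatively clopen. This lets a point
be moved within a piece without changing its membership in finitely many such sets. -/
theorem isClosed_sameType {X : Type*} [TopologicalSpace X] {P : Set X} (hP : IsClosed P)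
    {ι : Type*} (T : Finset ι) {S : ι → Set X} (hS : ∀ i, IsClosed (S i))
    (hS' : ∀ i, IsClosed (P \ S i)) (x : X) :
    IsClosed {w ∈ P | ∀ i ∈ T, (w ∈ S i ↔ x ∈ S i)} ∧
      IsClosed (P \ {w ∈ P | ∀ i ∈ T, (w ∈ S i ↔ x ∈ S i)}) := by
  constructor
  · have : {w ∈ P | ∀ i ∈ T, (w ∈ S i ↔ x ∈ S i)} =
        P ∩ ⋂ i ∈ T, {w | (w ∈ S i ∧ x ∈ S i) ∨ (w ∈ P \ S i ∧ x ∉ S i)} := by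
      ext w
      simp only [mem_ofPred_eq, mem_inter_iff, mem_iInter, mem_sdiff]
      refine and_congr_right fun hw => forall₂_congr fun i _ => ?_
      tauto
    rw [this]
    refine hP.inter (isClosed_biInter fun i _ => ?_)
    by_cases hx : x ∈ S i
    · simpa [hx] using hS i
    · simpa [hx, sdiff_eq, compl_def, inter_def] using hS' i
  · have : P \ {w ∈ P | ∀ i ∈ T, (w ∈ S i ↔ x ∈ S i)} =
        P ∩ ⋃ i ∈ T, {w | (w ∈ S i ∧ x ∉ S i) ∨ (w ∈ P \ S i ∧ x ∈ S i)} := by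
      ext w
      simp only [mem_ofPred_eq, mem_inter_iff, mem_iUnion, mem_sdiff, not_and, not_forall]
      refine and_congr_right fun hw => ?_
      simp only [hw, true_and, true_imp_iff]
      refine exists_congr fun i => exists_congr fun _ => ?_
      tauto
    rw [this]
    refine hP.inter (T.finite_toSet.isClosed_biUnion fun i _ => ?_)
    by_cases hx : x ∈ S i
    · simpa [hx, sdiff_eq, compl_def, inter_def] using hS' i
    · simpa [hx] using hS i

/-- If relatively clopen subsets of `Q` also meet `N`, then the flow has a recurrent point. -/
theorem IsCyclicCut.exists_isRecurrentPoint {X : Type*} [TopologicalSpace X] [CompactSpace X]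
    {P Q M N : Set X} (hc : IsCyclicCut P Q M N) (hN : N.Nonempty)
    (hQN : ∀ S ⊆ Q, IsClosed S → IsClosed (Q \ S) → S.Nonempty → (S ∩ N).Nonempty) :
    ∃ x : X, IsRecurrentPoint x := by
  by_contra! hcon
  have hNP : N ⊆ P := fun x hx => (hc.inter.symm.subset (Or.inr hx)).1
  have hNQ : N ⊆ Q := fun x hx => (hc.inter.symm.subset (Or.inr hx)).2
  have hMQ : M ⊆ Q := fun x hx => (hc.inter.symm.subset (Or.inl hx)).2
  have hex : ∀ x : N, ∃ S R, IsForwardPair P Q M N S R ∧ (x : X) ∈ S ∧ (x : X) ∉ R := by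
    intro x
    by_contra! h
    exact hcon x ⟨P, Q, M, N, hc, x.2, h⟩
  choose S R hSR hxS hxR using hex
  -- On `N`, which lies in `P`, the open set attached to `x` consists of the points in `S x` but not
  -- in `R x`.
  obtain ⟨T, hT⟩ := hc.closed_cut.isCompact.elim_finite_subcover
    (fun x : N => (P \ S x)ᶜ ∩ (R x)ᶜ)
    (fun x => (hSR x).closed_left'.isOpen_compl.inter (hSR x).closed_right.isOpen_compl)
    (fun x hx => mem_iUnion.2 ⟨⟨x, hx⟩, fun h => h.2 (hxS ⟨x, hx⟩), hxR ⟨x, hx⟩⟩)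
  classical
  let χ : X → Finset N := fun z => T.filter fun j => z ∈ R j
  obtain ⟨n, ⟨z, hzQ, rfl⟩, hmax⟩ : ∃ n, (∃ z ∈ Q, (χ z).card = n) ∧
      ∀ w ∈ Q, (χ w).card ≤ n := by
    have hb : ∀ w, (χ w).card ≤ T.card := fun w => Finset.card_filter_le _ _
    have hfin : ((fun w => (χ w).card) '' Q).Finite :=
      (finite_Iic T.card).subset (image_subset_iff.2 fun w _ => hb w)
    obtain ⟨x, hx⟩ := hN
    obtain ⟨n, hn, h⟩ := hfin.exists_maximal ⟨_, mem_image_of_mem _ (hNQ hx)⟩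
    refine ⟨n, hn, fun w hw => ?_⟩
    by_contra! hlt
    exact absurd (h (mem_image_of_mem _ hw) hlt.le) (not_le.2 hlt)
  obtain ⟨h1, h2⟩ := isClosed_sameType hc.closed_right T (fun i => (hSR i).closed_right)
    (fun i => (hSR i).closed_right') z
  -- From `z`, where the number of sets `R i` is maximal, one passes within `Q` to `x` in `N`, then
  -- within `P` to `m` in `M`. The condition `cut` at `x` loses no index, the cover gains one, and
  -- `mid` turns each `S i` back into `R i` at `m`.
  obtain ⟨x, ⟨-, hx⟩, hxN⟩ := hQN _ (fun w hw => hw.1) h1 h2 ⟨z, hzQ, fun _ _ => Iff.rfl⟩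
  obtain ⟨h1, h2⟩ := isClosed_sameType hc.closed_left T (fun i => (hSR i).closed_left)
    (fun i => (hSR i).closed_left') x
  obtain ⟨m, ⟨-, hm⟩, hmM⟩ := hc.left_meets _ (fun w hw => hw.1) h1 h2
    ⟨x, hNP hxN, fun _ _ => Iff.rfl⟩
  have hmR : ∀ i ∈ T, (m ∈ R i ↔ x ∈ S i) := fun i hi => by
    rw [← hm i hi]
    exact ⟨fun h => ((hSR i).mid.symm.subset ⟨h, hmM⟩).1, fun h => ((hSR i).mid.subset ⟨h, hmM⟩).1⟩
  refine absurd (hmax m (hMQ hmM)) (not_le.2 (Finset.card_lt_card ?_))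
  rw [Finset.ssubset_iff_of_subset]
  · obtain ⟨i, hi, hxi⟩ := mem_iUnion₂.1 (hT hxN)
    refine ⟨i, ?_, ?_⟩
    · have : x ∈ S i := by
        by_contra h
        exact hxi.1 ⟨hNP hxN, h⟩
      simpa [χ, hi] using (hmR i hi).2 this
    · simpa [χ, hi] using fun h => hxi.2 ((hx i hi).2 h)
  · intro i hi
    simp only [χ, Finset.mem_filter] at hi ⊢
    exact ⟨hi.1, (hmR i hi.1).2 ((hSR i).cut ⟨(hx i hi.1).2 hi.2, hxN⟩)⟩

/-! ### A recurrent point from a map onto the four-cycle. -/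

namespace TopGraph

theorem ConnectedSet.subset_of_isClosed {V : Type*} [TopologicalSpace V] {G : TopGraph V}
    {S U U' : Set V} (hS : G.ConnectedSet S) (hU : IsClosed U) (hU' : IsClosed U')
    (hcov : ∀ x ∈ S, x ∉ U → x ∈ U') (hdisj : ∀ x ∈ S, x ∈ U → x ∉ U')
    (hE : ∀ a ∈ S ∩ U, ∀ b ∈ S, G.Edge a b → b ∈ U) (hne : (S ∩ U).Nonempty) : S ⊆ U := by
  refine hS.subset_of_closed (hU.preimage continuous_subtype_val) ?_ hE hne
  rw [← isClosed_compl_iff]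
  convert hU'.preimage (continuous_subtype_val (p := (· ∈ S))) using 1
  ext x
  exact ⟨fun h => hcov x x.2 h, fun h h' => hdisj x x.2 h' h⟩

/-- Confluence over the edge `{a, b}` gives a connected set inside the preimage of `S` that reaches
the fibre of `b`. Confluence over `{b, c}` continues it to the fibre of `c`, and the edge where it
first leaves the fibre of `b` gives the common point. This supplies the meeting conditions of a
cyclic cut. -/
theorem exists_mem_inter_of_clopen {V : Type*} [TopologicalSpace V] {G : TopGraph V}
    (hG : ∀ a b c : V, G.Edge a b → G.Edge b c → G.Edge a c)
    {A : Type*} [TopologicalSpace A] [DiscreteTopology A] {K : TopGraph A} {k : V → A}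
    (hk : G.IsConfluentEpi K k) {a b c : A} (hab : K.Edge a b) (hbc : K.Edge b c)
    (hcb : c ≠ b) {P S : Set G.Realization} (hP : P = G.toRealization '' (k ⁻¹' {a, b}))
    (hSP : S ⊆ P) (hS : IsClosed S) (hS' : IsClosed (P \ S)) (hne : S.Nonempty) :
    (S ∩ (G.toRealization '' (k ⁻¹' {b}) ∩ G.toRealization '' (k ⁻¹' {c}))).Nonempty := by
  by_contra hcon
  have hE : ∀ x y, G.Edge x y → G.toRealization x = G.toRealization y := fun x y h =>
    (toRealization_eq_iff hG).2 h
  have hπ := G.continuous_toRealization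
  have hmem : ∀ x, k x = a ∨ k x = b → G.toRealization x ∈ P := fun x hx =>
    hP ▸ mem_image_of_mem _ hx
  obtain ⟨s, hs⟩ := hne
  obtain ⟨x, hx, rfl⟩ := hP.subset (hSP hs)
  have h1 : G.component (k ⁻¹' {a, b}) x ⊆ G.toRealization ⁻¹' S := by
    refine (G.connectedSet_component _ x).subset_of_isClosed (hS.preimage hπ) (hS'.preimage hπ)
      (fun y hy h => ⟨hmem y (G.component_subset _ x hy), h⟩) (fun y _ h h' => h'.2 h) ?_
      ⟨x, mem_component_self _ hx, hs⟩
    intro y hy z _ hyz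
    change _ ∈ S
    rw [← hE y z hyz]
    exact hy.2
  obtain ⟨y, hy, hyb⟩ : b ∈ k '' G.component (k ⁻¹' {a, b}) x :=
    (hk.confluent _ (connectedSet_pair hab) x hx).symm.subset (Or.inr rfl)
  have hb' : IsClosed (k ⁻¹' {b}) := (isClosed_discrete _).preimage hk.continuous
  have hc' : IsClosed (k ⁻¹' {c}) := (isClosed_discrete _).preimage hk.continuous
  have h2 : G.component (k ⁻¹' {b, c}) y ⊆ G.toRealization ⁻¹' S ∩ k ⁻¹' {b} := by
    refine (G.connectedSet_component _ y).subset_of_isClosed ((hS.preimage hπ).inter hb')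
      (((hS'.preimage hπ).inter hb').union hc') ?_ ?_ ?_
      ⟨y, mem_component_self _ (Or.inl hyb), h1 hy, hyb⟩
    · intro z hz h
      rcases component_subset _ _ _ hz with h' | h'
      · exact Or.inl ⟨⟨hmem z (Or.inr h'), fun h'' => h ⟨h'', h'⟩⟩, h'⟩
      · exact Or.inr h'
    · rintro z - h (h' | h')
      · exact h'.1.2 h.1
      · exact hcb (h'.symm.trans h.2)
    · rintro z ⟨-, hz1, hz2⟩ w hw hzw
      rcases component_subset _ _ _ hw with h' | h'
      · refine ⟨?_, h'⟩
        change _ ∈ S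
        rw [← hE z w hzw]
        exact hz1
      · exact absurd ⟨_, hz1, ⟨z, hz2, rfl⟩, ⟨w, h', (hE z w hzw).symm⟩⟩ hcon
  obtain ⟨z, hz, hzc⟩ : c ∈ k '' G.component (k ⁻¹' {b, c}) y :=
    (hk.confluent _ (connectedSet_pair hbc) y (Or.inl hyb)).symm.subset (Or.inr rfl)
  exact hcb (hzc.symm.trans (h2 hz).2)

/-- The cycle of length four. -/
def fourCycle : TopGraph (Fin 4) where
  Edge i j := j = i ∨ j = i + 1 ∨ i = j + 1
  refl _ := Or.inl rfl
  symm i j := by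
    rintro (h | h | h)
    exacts [Or.inl h.symm, Or.inr (Or.inr h), Or.inr (Or.inl h)]
  closed := isClosed_discrete _

theorem connected_fourCycle : fourCycle.Connected := by
  rw [connected_iff_reach]
  have key : ∀ i : Fin 4, fourCycle.Reach univ 0 i := by
    have h1 : fourCycle.Reach univ 0 1 := ReflTransGen.single ⟨Or.inr (Or.inl rfl), mem_univ _⟩
    have h2 : fourCycle.Reach univ 0 2 := h1.tail ⟨Or.inr (Or.inl rfl), mem_univ _⟩
    have h3 : fourCycle.Reach univ 0 3 := h2.tail ⟨Or.inr (Or.inl rfl), mem_univ _⟩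
    intro i
    fin_cases i
    exacts [ReflTransGen.refl, h1, h2, h3]
  exact ⟨⟨0⟩, fun i j => ((key i).symm (mem_univ _)).trans (key j)⟩

end TopGraph

open TopGraph in
theorem IsConfluentFraisseLimit.exists_isRecurrentPoint {V : Type*} [TopologicalSpace V]
    {G : TopGraph V} (hG : IsConfluentFraisseLimit G) :
    ∃ x : G.Realization, IsRecurrentPoint x := by
  have := hG.compactSpace
  have := hG.isContinuum_realization.1
  obtain ⟨k, hk⟩ := hG.projective_universal (Fin 4) fourCycle connected_fourCycle
  have hcl := isClosedMap_toRealization hG.edge_trans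
  have hclosed : ∀ s : Set (Fin 4), IsClosed (G.toRealization '' (k ⁻¹' s)) := fun s =>
    hcl _ ((isClosed_discrete s).preimage hk.continuous)
  have hedge : ∀ x y, G.toRealization x = G.toRealization y →
      k y = k x ∨ k y = k x + 1 ∨ k x = k y + 1 := fun x y h =>
    hk.map_edge _ _ ((toRealization_eq_iff hG.edge_trans).1 h)
  have hmono : ∀ {s t : Set (Fin 4)}, s ⊆ t →
      G.toRealization '' (k ⁻¹' s) ⊆ G.toRealization '' (k ⁻¹' t) := fun h =>
    image_mono (preimage_mono h)
  let F : Fin 4 → Set G.Realization := fun i => G.toRealization '' (k ⁻¹' {i})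
  have hmeet := fun (a b c : Fin 4) (hab : fourCycle.Edge a b) (hbc : fourCycle.Edge b c) hcb =>
    @exists_mem_inter_of_clopen V _ G hG.edge_trans (Fin 4) _ _ _ k hk a b c hab hbc hcb
      (G.toRealization '' (k ⁻¹' {a, b}))
  have h01 : fourCycle.Edge 0 1 := Or.inr (Or.inl rfl)
  have h12 : fourCycle.Edge 1 2 := Or.inr (Or.inl rfl)
  have h23 : fourCycle.Edge 2 3 := Or.inr (Or.inl rfl)
  have h30 : fourCycle.Edge 3 0 := Or.inr (Or.inl rfl)
  have hcut : IsCyclicCut (G.toRealization '' (k ⁻¹' {0, 1})) (G.toRealization '' (k ⁻¹' {2, 3}))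
      (F 1 ∩ F 2) (F 3 ∩ F 0) := by
    refine ⟨hclosed _, hclosed _, (hclosed _).inter (hclosed _), (hclosed _).inter (hclosed _),
      ?_, ?_, ?_, ?_, ?_⟩
    · rw [← image_union, ← preimage_union]
      have : ({0, 1} ∪ {2, 3} : Set (Fin 4)) = univ := by
        ext i
        fin_cases i <;> simp
      rw [this, preimage_univ, image_univ, G.surjective_toRealization.range_eq]
    · apply Subset.antisymm
      · rintro _ ⟨⟨x, hx, rfl⟩, ⟨y, hy, hxy⟩⟩
        have h := hedge y x hxy
        rcases hx with hx | hx <;> rcases hy with hy | hy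
        · exfalso
          rw [hx, hy] at h
          revert h
          decide
        · exact Or.inr ⟨⟨y, hy, hxy⟩, ⟨x, hx, rfl⟩⟩
        · exact Or.inl ⟨⟨x, hx, rfl⟩, ⟨y, hy, hxy⟩⟩
        · exfalso
          rw [hx, hy] at h
          revert h
          decide
      · rintro q (⟨h1, h2⟩ | ⟨h1, h2⟩)
        · exact ⟨hmono (by simp) h1, hmono (by simp) h2⟩
        · exact ⟨hmono (by simp) h2, hmono (by simp) h1⟩
    · rw [disjoint_left]
      rintro _ ⟨⟨x, hx, rfl⟩, -⟩ ⟨⟨y, hy, hxy⟩, -⟩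
      have h := hedge y x hxy
      rw [show k x = 1 from hx, show k y = 3 from hy] at h
      revert h
      decide
    · intro S hS h1 h2 h3
      exact hmeet 0 1 2 h01 h12 (by decide) rfl hS h1 h2 h3
    · intro S hS h1 h2 h3
      -- The cycle is traversed backwards here, to reach `M` from `Q`; going forwards from `Q` gives
      -- `N` below.
      have := hmeet 3 2 1 (fourCycle.symm _ _ h23) (fourCycle.symm _ _ h12) (by decide)
        (S := S) rfl (by rwa [pair_comm]) h1 (by rwa [pair_comm]) h3
      rwa [inter_comm (G.toRealization '' (k ⁻¹' {2}))] at this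
  have hmeetN : ∀ S ⊆ G.toRealization '' (k ⁻¹' {2, 3}), IsClosed S →
      IsClosed (G.toRealization '' (k ⁻¹' {2, 3}) \ S) → S.Nonempty → (S ∩ (F 3 ∩ F 0)).Nonempty :=
    fun S hS h1 h2 h3 => hmeet 2 3 0 h23 h30 (by decide) rfl hS h1 h2 h3
  refine hcut.exists_isRecurrentPoint ?_ hmeetN
  obtain ⟨x, hx⟩ := hk.surjective 2
  exact (hmeetN _ subset_rfl (hclosed _) (by simp) ⟨_, x, Or.inl hx, rfl⟩).mono inter_subset_right

/-! ### Generic vertices. -/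

namespace TopGraph

theorem isConfluentEpi_of_equiv {V W : Type*} [TopologicalSpace V] [TopologicalSpace W]
    {G : TopGraph V} {H : TopGraph W} (e : V ≃ W) (hc : Continuous e) (hc' : Continuous e.symm)
    (hE : ∀ a b, G.Edge a b ↔ H.Edge (e a) (e b)) : G.IsConfluentEpi H e where
  continuous := hc
  map_edge a b h := (hE a b).1 h
  surjective := e.surjective
  surjective_edge c d h :=
    ⟨e.symm c, e.symm d, (hE _ _).2 (by simpa using h), by simp, by simp⟩
  confluent Q hQ a ha := by
    refine image_component_eq (C := e.symm '' Q)
      (hQ.image (f := e.symm) hc' fun x y h => (hE _ _).2 (by simpa using h)) ⟨e a, ha, by simp⟩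
      ?_ ?_
    · rintro _ ⟨x, hx, rfl⟩
      simpa using hx
    · intro x hx
      exact ⟨e.symm x, ⟨x, hx, rfl⟩, by simp⟩

/-- A copy of a graph on a discrete space. -/
def transport {A B : Type*} [TopologicalSpace A] [TopologicalSpace B] [DiscreteTopology B]
    (K : TopGraph A) (e : A ≃ B) : TopGraph B where
  Edge x y := K.Edge (e.symm x) (e.symm y)
  refl _ := K.refl _
  symm _ _ h := K.symm _ _ h
  closed := isClosed_discrete _

section transport

variable {A B : Type*} [TopologicalSpace A] [DiscreteTopology A] [TopologicalSpace B]
  [DiscreteTopology B]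

theorem isConfluentEpi_transport (K : TopGraph A) (e : A ≃ B) :
    K.IsConfluentEpi (K.transport e) e :=
  isConfluentEpi_of_equiv e continuous_of_discreteTopology continuous_of_discreteTopology
    fun a b => by simp [transport]

theorem isConfluentEpi_transport_symm (K : TopGraph A) (e : A ≃ B) :
    (K.transport e).IsConfluentEpi K e.symm :=
  isConfluentEpi_of_equiv e.symm continuous_of_discreteTopology continuous_of_discreteTopology
    fun _ _ => Iff.rfl

end transport

theorem Connected.of_isEpi {A B : Type*} [TopologicalSpace A] [TopologicalSpace B]
    {K : TopGraph A} {L : TopGraph B} {f : A → B} (hK : K.Connected) (hf : K.IsEpi L f) :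
    L.Connected :=
  ⟨hK.1.map f, by
    rw [← image_univ_of_surjective hf.surjective]
    exact hK.2.image hf.continuous hf.map_edge⟩

instance finite {A : Type*} [TopologicalSpace A] [Finite A] : Finite (TopGraph A) :=
  Finite.of_injective (fun K : TopGraph A => K.Edge) fun K L h => by
    cases K
    cases L
    congr

end TopGraph

open TopGraph

/-- A point of a limit that is sent to any prescribed vertex by some solution of an extension
problem. -/
def IsGenericVertex {V : Type*} [TopologicalSpace V] (G : TopGraph V) (y : V) : Prop :=
  ∀ (A B : Type) [Finite A] [TopologicalSpace A] [DiscreteTopology A]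
    [Finite B] [TopologicalSpace B] [DiscreteTopology B] (K : TopGraph A) (L : TopGraph B),
    K.Connected → L.Connected → ∀ (f : V → A) (g : B → A) (b : B),
    G.IsConfluentEpi K f → L.IsConfluentEpi K g → g b = f y →
    ∃ h : V → B, G.IsConfluentEpi L h ∧ f = g ∘ h ∧ h y = b

namespace IsConfluentFraisseLimit

variable {V : Type*} [TopologicalSpace V] {G : TopGraph V}

/-- The extension problem is refined to a quotient `r` whose fibre through `y` lies in `U`, and
amalgamated with base point `(r y, b)`. A vertex sent to the base point then lies in `U` and is sent
to `b`. This is the density needed for the Baire argument. -/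
theorem exists_extension_mem (hG : IsConfluentFraisseLimit G) {A B : Type}
    [TopologicalSpace A] [DiscreteTopology A] [Finite A]
    [TopologicalSpace B] [DiscreteTopology B] [Finite B] {K : TopGraph A} {L : TopGraph B}
    (hL : L.Connected) {f : V → A} {g : B → A} {b : B}
    (hf : G.IsConfluentEpi K f) (hg : L.IsConfluentEpi K g) {y : V} (hb : g b = f y) {U : Set V}
    (hU : IsOpen U) (hy : y ∈ U) :
    ∃ h : V → B, G.IsConfluentEpi L h ∧ f = g ∘ h ∧ ∃ z ∈ U, h z = b := by
  have := hG.t2Space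
  obtain ⟨C, i1, i2, i3, M, r, hM, hr, hfib⟩ := hG.exists_fibres_subset
    (U := fun i : Bool × A => (if i.1 then U else {y}ᶜ) ∩ f ⁻¹' {i.2}) (by
      rintro ⟨i, j⟩
      refine IsOpen.inter ?_ ((isOpen_discrete _).preimage hf.continuous)
      cases i
      · simp
      · simpa using hU) (by
      intro x
      by_cases h : x = y
      · exact ⟨(true, f x), by simpa [h] using hy⟩
      · exact ⟨(false, f x), by simpa using h⟩)
  have hrf : ∀ x z, r x = r z → f x = f z := by
    intro x z hxz
    obtain ⟨⟨i, j⟩, hij⟩ := hfib x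
    have h1 : f x = j := (hij (show x ∈ r ⁻¹' {r x} from rfl)).2
    have h2 : f z = j := (hij (show z ∈ r ⁻¹' {r x} from hxz.symm)).2
    exact h1.trans h2.symm
  have hrU : ∀ z, r z = r y → z ∈ U := by
    intro z hz
    obtain ⟨⟨i, j⟩, hij⟩ := hfib y
    cases i
    · exact absurd rfl (hij (show y ∈ r ⁻¹' {r y} from rfl)).1
    · exact (hij (show z ∈ r ⁻¹' {r y} from hz)).1
  let σ : C → A := fun c => f (Function.surjInv hr.surjective c)
  have hσ : σ ∘ r = f := funext fun x => hrf _ _ (Function.surjInv_eq hr.surjective (r x))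
  have hσK : M.IsConfluentEpi K σ :=
    IsConfluentEpi.of_comp continuous_of_discreteTopology (hσ.symm ▸ hf) hr.toIsEpi
  obtain ⟨D, j1, j2, j3, N, p, q, d, hN, hp, hq, hpq, hpd, hqd⟩ :=
    exists_amalgam hM hL hσK hg (b := r y) (c := b) ((congrFun hσ y).trans hb.symm)
  obtain ⟨h, hh, hrh⟩ := hG.extension C D M N hM hN r p hr hp
  refine ⟨q ∘ h, hq.comp hh, ?_, ?_⟩
  · rw [← hσ, hrh, ← Function.comp_assoc, hpq, Function.comp_assoc]
  · obtain ⟨z, hz⟩ := hh.surjective d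
    refine ⟨z, hrU z ?_, ?_⟩
    · rw [hrh, Function.comp_apply, hz, hpd, ← hrh]
    · rw [Function.comp_apply, hz, hqd]

theorem exists_isGenericVertex (hG : IsConfluentFraisseLimit G) : ∃ y, IsGenericVertex G y := by
  have := hG.compactSpace
  have := hG.t2Space
  have := hG.totallyDisconnectedSpace
  have h2 := hG.secondCountableTopology
  have := hG.nonempty
  have hcl : Countable (TopologicalSpace.Clopens V) :=
    TopologicalSpace.Clopens.countable_iff_secondCountable.2 h2
  have hcf : ∀ n, Countable {f : V → Fin n // Continuous f} := fun n => by
    refine Function.Injective.countable (f := fun f (j : Fin n) =>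
      (⟨f.1 ⁻¹' {j}, (isClopen_discrete _).preimage f.2⟩ : TopologicalSpace.Clopens V)) ?_
    rintro ⟨f, hf⟩ ⟨g, hg⟩ hfg
    ext x
    have h1 : f ⁻¹' {f x} = g ⁻¹' {f x} := congrArg (fun s => (s (f x) : Set V)) hfg
    have h3 : x ∈ g ⁻¹' {f x} := h1 ▸ rfl
    exact congrArg Fin.val h3.symm
  let I : Type _ := Σ (m n : ℕ), {f : V → Fin m // Continuous f} × (Fin n → Fin m) × Fin n ×
    TopGraph (Fin m) × TopGraph (Fin n)
  -- Up to isomorphism there are only countably many extension problems with a target vertex. Each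
  -- set is stated as an implication, so that it is open and dense also for invalid data.
  let O : I → Set V := fun i => {y | G.IsConfluentEpi i.2.2.2.2.2.1 i.2.2.1.1 →
    i.2.2.2.2.2.2.Connected → i.2.2.2.2.2.2.IsConfluentEpi i.2.2.2.2.2.1 i.2.2.2.1 →
    i.2.2.2.1 i.2.2.2.2.1 = i.2.2.1.1 y →
    ∃ h : V → Fin i.2.1, G.IsConfluentEpi i.2.2.2.2.2.2 h ∧ i.2.2.1.1 = i.2.2.2.1 ∘ h ∧
      h y = i.2.2.2.2.1}
  have hO : ∀ i, IsOpen (O i) := by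
    rintro ⟨m, n, f, g, b, K, L⟩
    rw [isOpen_iff_forall_mem_open]
    intro y hy
    by_cases hyb : g b = f.1 y
    · by_cases hv : G.IsConfluentEpi K f.1 ∧ L.Connected ∧ L.IsConfluentEpi K g
      · obtain ⟨h, hh, hfg, hhb⟩ := hy hv.1 hv.2.1 hv.2.2 hyb
        exact ⟨h ⁻¹' {b}, fun z hz _ _ _ _ => ⟨h, hh, hfg, hz⟩,
          (isOpen_discrete _).preimage hh.continuous, hhb⟩
      · exact ⟨univ, fun z _ h1 h2 h3 => absurd ⟨h1, h2, h3⟩ hv, isOpen_univ, mem_univ _⟩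
    · exact ⟨f.1 ⁻¹' {f.1 y}, fun z hz _ _ _ h => absurd (h.trans hz) hyb,
        (isOpen_discrete _).preimage f.2, rfl⟩
  have hD : ∀ i, Dense (O i) := by
    rintro ⟨m, n, f, g, b, K, L⟩
    rw [dense_iff_inter_open]
    rintro U hU ⟨y, hy⟩
    by_contra hne
    have hy' : y ∉ O ⟨m, n, f, g, b, K, L⟩ := fun h => hne ⟨y, hy, h⟩
    simp only [O, mem_ofPred_eq, Classical.not_imp] at hy'
    obtain ⟨hf, hL, hg, hb, -⟩ := hy'
    obtain ⟨h, hh, hfg, z, hzU, hz⟩ := hG.exists_extension_mem hL hf hg hb hU hy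
    exact hne ⟨z, hzU, fun _ _ _ _ => ⟨h, hh, hfg, hz⟩⟩
  obtain ⟨y, hy⟩ := (dense_iInter_of_isOpen hO hD).nonempty
  rw [mem_iInter] at hy
  refine ⟨y, fun A B _ _ _ _ _ _ K L hK hL f g b hf hg hb => ?_⟩
  obtain ⟨m, ⟨e⟩⟩ := Finite.exists_equiv_fin A
  obtain ⟨n, ⟨e'⟩⟩ := Finite.exists_equiv_fin B
  have hf' := (K.isConfluentEpi_transport e).comp hf
  obtain ⟨h, hh, hfg, hhb⟩ := hy ⟨m, n, ⟨e ∘ f, hf'.continuous⟩, e ∘ g ∘ e'.symm, e' b,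
    K.transport e, L.transport e'⟩ hf' (hL.of_isEpi (L.isConfluentEpi_transport e').toIsEpi)
    ((K.isConfluentEpi_transport e).comp (hg.comp (L.isConfluentEpi_transport_symm e')))
    (by simp [hb])
  refine ⟨e'.symm ∘ h, (L.isConfluentEpi_transport_symm e').comp hh, ?_, by simp [hhb]⟩
  funext x
  exact e.injective (congrFun hfg x)

end IsConfluentFraisseLimit

/-! ### Two-sheeted graphs, and generic vertices are not recurrent. -/

namespace TopGraph

section twoSheet

variable {C : Type} [TopologicalSpace C] [DiscreteTopology C]

/-- Two copies of a graph that is covered by `P` and `Q`, with additional vertices over a part `N`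
of `P ∩ Q` which lead from the first copy of `Q` to the second copy of `P`. -/
def twoSheet (K : TopGraph C) (P Q N : Set C) :
    TopGraph {x : C × Bool × Bool // (x.2.1 = true → x.2.2 = true) ∧ (x.1 ∉ N → x.2.1 = x.2.2)} where
  Edge x y := K.Edge x.1.1 y.1.1 ∧ (x.1.1 ∈ P → y.1.1 ∈ P → x.1.2.2 = y.1.2.2) ∧
    (x.1.1 ∈ Q → y.1.1 ∈ Q → x.1.2.1 = y.1.2.1)
  refl _ := ⟨K.refl _, fun _ _ => rfl, fun _ _ => rfl⟩
  symm _ _ h := ⟨K.symm _ _ h.1, fun h1 h2 => (h.2.1 h2 h1).symm, fun h1 h2 => (h.2.2 h2 h1).symm⟩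
  closed := isClosed_discrete _

/-- A vertex `(c, q, p)` carries a label `q` for the sheet of `Q` and `p` for that of `P`; they may
differ only over `N`, as `(false, true)`. Walks in `P` preserve `p` and walks in `Q` preserve `q`.
By `hP` and `hQ` such walks leave `N`, where the labels agree, so every vertex is joined to a full
copy of `K`. A mixed vertex is joined to both copies. -/
theorem twoSheet_spec {K : TopGraph C} (hK : K.Connected) {P Q N : Set C}
    (hN : N ⊆ P ∩ Q) (hne : N.Nonempty)
    (hcov : ∀ c d, K.Edge c d → (c ∈ P ∧ d ∈ P) ∨ (c ∈ Q ∧ d ∈ Q))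
    (hstep : ∀ c d, K.Edge c d → c ∈ N → d ∈ P ∩ Q → d ∈ N)
    (hP : ∀ c ∈ P, ∃ m ∈ P ∩ Q, m ∉ N ∧ K.Reach P c m)
    (hQ : ∀ c ∈ Q, ∃ m ∈ P ∩ Q, m ∉ N ∧ K.Reach Q c m) :
    (K.twoSheet P Q N).Connected ∧ (K.twoSheet P Q N).IsConfluentEpi K fun x => x.1.1 := by
  -- Both labels are kept if `d` is in `N`; otherwise `p` is duplicated for an edge in `P`, and `q`
  -- for any other. If the edge lies in `P` and in `Q`, `hstep` keeps `c` out of `N`, so `p` and `q`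
  -- agree.
  have hlift : ∀ x d, K.Edge x.1.1 d → ∃ y, (K.twoSheet P Q N).Edge x y ∧ y.1.1 = d := by
    rintro ⟨⟨c, q, p⟩, h1, h2⟩ d (hcd : K.Edge c d)
    simp only at h1 h2
    by_cases hd : d ∈ N
    · exact ⟨⟨⟨d, q, p⟩, h1, fun h => absurd hd h⟩, ⟨hcd, fun _ _ => rfl, fun _ _ => rfl⟩, rfl⟩
    · by_cases hcdP : c ∈ P ∧ d ∈ P
      · exact ⟨⟨⟨d, p, p⟩, id, fun _ => rfl⟩, ⟨hcd, fun _ _ => rfl, fun hc hd' =>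
          h2 fun hcN => hd (hstep c d hcd hcN ⟨hcdP.2, hd'⟩)⟩, rfl⟩
      · exact ⟨⟨⟨d, q, q⟩, id, fun _ => rfl⟩, ⟨hcd, fun hc hd' => absurd ⟨hc, hd'⟩ hcdP,
          fun _ _ => rfl⟩, rfl⟩
  have hl : (K.twoSheet P Q N).LiftsEdges K fun x => x.1.1 := by
    intro x d hd
    obtain ⟨y, hy, hyd⟩ := hlift x d hd
    exact ⟨y, ReflTransGen.single ⟨hy, Or.inr hyd⟩, hyd⟩
  have hK' := (connected_iff_reach K).1 hK
  obtain ⟨c₀, hc₀⟩ := hne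
  let d₀ : {x : C × Bool × Bool // (x.2.1 = true → x.2.2 = true) ∧ (x.1 ∉ N → x.2.1 = x.2.2)} :=
    ⟨⟨c₀, false, true⟩, by simp, fun h => absurd hc₀ h⟩
  have hdiag : ∀ (s : Bool) (c d : C), (K.twoSheet P Q N).Reach univ
      ⟨⟨c, s, s⟩, id, fun _ => rfl⟩ ⟨⟨d, s, s⟩, id, fun _ => rfl⟩ := fun s c d =>
    (hK'.2 c d).map (H := K.twoSheet P Q N) (f := fun c => ⟨⟨c, s, s⟩, id, fun _ => rfl⟩)
      (fun a b h => ⟨h, fun _ _ => rfl, fun _ _ => rfl⟩) fun _ _ => mem_univ _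
  have hreachP : ∀ x, x.1.1 ∈ P → ∀ c, (K.twoSheet P Q N).Reach univ x
      ⟨⟨c, x.1.2.2, x.1.2.2⟩, id, fun _ => rfl⟩ := by
    intro x hx c
    have key : ∀ v, K.Reach P x.1.1 v → ∃ y, (K.twoSheet P Q N).Reach univ x y ∧ y.1.1 = v ∧
        y.1.2.2 = x.1.2.2 := by
      intro v hv
      induction hv with
      | refl => exact ⟨x, ReflTransGen.refl, rfl, rfl⟩
      | @tail v w h1 h2 ih =>
        obtain ⟨y, hy, rfl, hys⟩ := ih
        obtain ⟨z, hz, rfl⟩ := hlift y w h2.1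
        exact ⟨z, hy.tail ⟨hz, mem_univ _⟩, rfl, (hz.2.1 (Reach.mem h1 hx) h2.2).symm.trans hys⟩
    obtain ⟨m, -, hmN, hm⟩ := hP _ hx
    obtain ⟨⟨⟨v, q, p⟩, h1, h2⟩, hy, rfl, rfl⟩ := key m hm
    obtain rfl : q = x.1.2.2 := h2 hmN
    exact hy.trans (hdiag _ _ _)
  have hreachQ : ∀ x, x.1.1 ∈ Q → ∀ c, (K.twoSheet P Q N).Reach univ x
      ⟨⟨c, x.1.2.1, x.1.2.1⟩, id, fun _ => rfl⟩ := by
    intro x hx c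
    have key : ∀ v, K.Reach Q x.1.1 v → ∃ y, (K.twoSheet P Q N).Reach univ x y ∧ y.1.1 = v ∧
        y.1.2.1 = x.1.2.1 := by
      intro v hv
      induction hv with
      | refl => exact ⟨x, ReflTransGen.refl, rfl, rfl⟩
      | @tail v w h1 h2 ih =>
        obtain ⟨y, hy, rfl, hys⟩ := ih
        obtain ⟨z, hz, rfl⟩ := hlift y w h2.1
        exact ⟨z, hy.tail ⟨hz, mem_univ _⟩, rfl, (hz.2.2 (Reach.mem h1 hx) h2.2).symm.trans hys⟩
    obtain ⟨m, -, hmN, hm⟩ := hQ _ hx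
    obtain ⟨⟨⟨v, q, p⟩, h1, h2⟩, hy, rfl, rfl⟩ := key m hm
    obtain rfl : x.1.2.1 = p := h2 hmN
    exact hy.trans (hdiag _ _ _)
  have hd₀ : ∀ s c, (K.twoSheet P Q N).Reach univ d₀ ⟨⟨c, s, s⟩, id, fun _ => rfl⟩ := by
    rintro (_ | _) c
    · exact hreachQ d₀ (hN hc₀).2 c
    · exact hreachP d₀ (hN hc₀).1 c
  have hall : ∀ x, (K.twoSheet P Q N).Reach univ d₀ x := by
    intro x
    rcases hcov _ _ (K.refl x.1.1) with h | h
    · exact (hd₀ _ c₀).trans ((hreachP x h.1 c₀).symm (mem_univ _))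
    · exact (hd₀ _ c₀).trans ((hreachQ x h.1 c₀).symm (mem_univ _))
  have : Nonempty {x : C × Bool × Bool //
    (x.2.1 = true → x.2.2 = true) ∧ (x.1 ∉ N → x.2.1 = x.2.2)} := ⟨d₀⟩
  refine ⟨(connected_iff_reach _).2 ⟨this, fun x y => ((hall x).symm (mem_univ _)).trans (hall y)⟩,
    isConfluentEpi_of_liftsEdges hK (fun _ _ h => h.1) hl⟩

end twoSheet

/-- Clopen pieces of a closed subset of the realization that are given by a finite quotient. -/
theorem isClosed_image_piece {V : Type*} [TopologicalSpace V] [CompactSpace V] {G : TopGraph V}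
    (hG : ∀ a b c : V, G.Edge a b → G.Edge b c → G.Edge a c) {P : Set G.Realization}
    (hP : IsClosed P) {C : Type*} [TopologicalSpace C] [DiscreteTopology C] {f : V → C}
    (hf : Continuous f) {T : Set C}
    (hT : ∀ x y, G.Edge x y → G.toRealization x ∈ P → f x ∈ T → f y ∈ T) :
    ∃ S ⊆ P, IsClosed S ∧ IsClosed (P \ S) ∧
      ∀ x, G.toRealization x ∈ P → (G.toRealization x ∈ S ↔ f x ∈ T) := by
  have hmem : ∀ x, G.toRealization x ∈ P →
      (G.toRealization x ∈ G.toRealization '' (G.toRealization ⁻¹' P ∩ f ⁻¹' T) ↔ f x ∈ T) := by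
    refine fun x hx => ⟨?_, fun h => ⟨x, ⟨hx, h⟩, rfl⟩⟩
    rintro ⟨y, ⟨hy, hyT⟩, hyx⟩
    exact hT y x ((toRealization_eq_iff hG).1 hyx) hy hyT
  have hcl := isClosedMap_toRealization hG
  have hP' := hP.preimage G.continuous_toRealization
  refine ⟨_, image_subset_iff.2 inter_subset_left,
    hcl _ (hP'.inter ((isClosed_discrete T).preimage hf)), ?_, hmem⟩
  have : P \ G.toRealization '' (G.toRealization ⁻¹' P ∩ f ⁻¹' T) =
      G.toRealization '' (G.toRealization ⁻¹' P ∩ f ⁻¹' Tᶜ) := by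
    ext q
    obtain ⟨x, rfl⟩ := G.surjective_toRealization q
    constructor
    · rintro ⟨h1, h2⟩
      exact ⟨x, ⟨h1, fun h => h2 ((hmem x h1).2 h)⟩, rfl⟩
    · rintro ⟨y, ⟨hy, hyT⟩, hyx⟩
      rw [← hyx]
      exact ⟨hy, fun h => hyT ((hmem y hy).1 h)⟩
  rw [this]
  exact hcl _ (hP'.inter ((isClosed_discrete Tᶜ).preimage hf))

end TopGraph

/-- The labels of a lift to the two-sheeted graph define the forward pair: `S` is where the
`P`-label is `true`, `R` where the `Q`-label is. Over `M` the labels agree, and over `N` the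
`Q`-label implies the `P`-label. -/
theorem IsGenericVertex.not_isRecurrentPoint {V : Type*} [TopologicalSpace V] {G : TopGraph V}
    (hG : IsConfluentFraisseLimit G) {y : V} (hy : IsGenericVertex G y) :
    ¬ IsRecurrentPoint (G.toRealization y) := by
  rintro ⟨P, Q, M, N, hc, hyN, hrec⟩
  have := hG.compactSpace
  have htr := hG.edge_trans
  obtain ⟨hX1, -, hX2⟩ := hG.isContinuum_realization
  have hNP : N ⊆ P := fun x hx => (hc.inter.symm.subset (Or.inr hx)).1
  have hNQ : N ⊆ Q := fun x hx => (hc.inter.symm.subset (Or.inr hx)).2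
  have hMP : M ⊆ P := fun x hx => (hc.inter.symm.subset (Or.inl hx)).1
  have hMQ : M ⊆ Q := fun x hx => (hc.inter.symm.subset (Or.inl hx)).2
  have hE : ∀ x z, G.Edge x z → G.toRealization x = G.toRealization z := fun x z h =>
    (toRealization_eq_iff htr).2 h
  obtain ⟨U, W, hU, hW, hMU, hNW, hUW⟩ := SeparatedNhds.of_isCompact_isCompact
    hc.closed_mid.isCompact hc.closed_cut.isCompact hc.disjoint
  -- With this cover, a fibre that meets the preimages of both `P` and `Q` lies entirely over `U` or
  -- entirely over `W`.
  obtain ⟨C, i1, i2, i3, K, f, hK, hf, hfib⟩ := hG.exists_fibres_subset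
    (U := fun s : ({U, W, Pᶜ, Qᶜ} : Set (Set G.Realization)) => G.toRealization ⁻¹' s) (by
      rintro ⟨s, rfl | rfl | rfl | rfl⟩
      exacts [hU.preimage G.continuous_toRealization, hW.preimage G.continuous_toRealization,
        hc.closed_left.isOpen_compl.preimage G.continuous_toRealization,
        hc.closed_right.isOpen_compl.preimage G.continuous_toRealization]) (by
      intro x
      by_cases h1 : G.toRealization x ∈ P
      · by_cases h2 : G.toRealization x ∈ Q
        · rcases hc.inter.subset ⟨h1, h2⟩ with h | h
          · exact ⟨⟨U, by simp⟩, hMU h⟩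
          · exact ⟨⟨W, by simp⟩, hNW h⟩
        · exact ⟨⟨Qᶜ, by simp⟩, h2⟩
      · exact ⟨⟨Pᶜ, by simp⟩, h1⟩)
  let OP : Set C := f '' (G.toRealization ⁻¹' P)
  let OQ : Set C := f '' (G.toRealization ⁻¹' Q)
  let ON : Set C := {c | c ∈ OP ∩ OQ ∧ ∀ x, f x = c → G.toRealization x ∈ W}
  have hPQ : ∀ c ∈ OP ∩ OQ, (∀ x, f x = c → G.toRealization x ∈ U) ∨
      ∀ x, f x = c → G.toRealization x ∈ W := by
    rintro _ ⟨⟨p, hp, rfl⟩, ⟨q, hq, hqp⟩⟩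
    obtain ⟨⟨s, rfl | rfl | rfl | rfl⟩, hs⟩ := hfib p
    · exact Or.inl fun x hx => hs hx
    · exact Or.inr fun x hx => hs hx
    · exact absurd hp (hs (show p ∈ f ⁻¹' {f p} from rfl))
    · exact absurd hq (hs hqp)
  have hM : ∀ x, G.toRealization x ∈ M → f x ∈ OP ∩ OQ ∧ f x ∉ ON := fun x hx =>
    ⟨⟨⟨x, hMP hx, rfl⟩, ⟨x, hMQ hx, rfl⟩⟩, fun h => disjoint_left.1 hUW (hMU hx) (h.2 x rfl)⟩
  have hcov : ∀ c d, K.Edge c d → (c ∈ OP ∧ d ∈ OP) ∨ (c ∈ OQ ∧ d ∈ OQ) := by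
    intro c d hcd
    obtain ⟨x, z, hxz, rfl, rfl⟩ := hf.surjective_edge c d hcd
    have h : G.toRealization x ∈ P ∪ Q := hc.union.symm.subset (mem_univ _)
    refine h.imp (fun h => ⟨⟨x, h, rfl⟩, ⟨z, ?_, rfl⟩⟩) fun h => ⟨⟨x, h, rfl⟩, ⟨z, ?_, rfl⟩⟩
    all_goals
      rw [mem_preimage, ← hE x z hxz]
      exact h
  have hstep : ∀ c d, K.Edge c d → c ∈ ON → d ∈ OP ∩ OQ → d ∈ ON := by
    intro c d hcd hc hd
    obtain ⟨x, z, hxz, rfl, rfl⟩ := hf.surjective_edge c d hcd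
    refine ⟨hd, (hPQ _ hd).resolve_left fun h => ?_⟩
    exact disjoint_left.1 hUW (h z rfl) (hE x z hxz ▸ hc.2 x rfl)
  -- The vertices reachable within the image of a piece define a relatively clopen part of that
  -- piece, which must meet `M`.
  have hmeet : ∀ (P' : Set G.Realization), IsClosed P' → (∀ S ⊆ P', IsClosed S → IsClosed (P' \ S) →
      S.Nonempty → (S ∩ M).Nonempty) → M ⊆ P' → ∀ c ∈ f '' (G.toRealization ⁻¹' P'),
      ∃ m ∈ OP ∩ OQ, m ∉ ON ∧ K.Reach (f '' (G.toRealization ⁻¹' P')) c m := by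
    rintro P' hP' hS hMP' _ ⟨x, hx, rfl⟩
    obtain ⟨S, hSP, h1, h2, h3⟩ := isClosed_image_piece htr hP' hf.continuous
      (T := {v | K.Reach (f '' (G.toRealization ⁻¹' P')) (f x) v}) (by
        intro z w hzw hz hzT
        refine ReflTransGen.tail hzT ⟨hf.map_edge _ _ hzw, w, ?_, rfl⟩
        rw [mem_preimage, ← hE z w hzw]
        exact hz)
    obtain ⟨q, hqS, hqM⟩ := hS S hSP h1 h2 ⟨_, (h3 x hx).2 ReflTransGen.refl⟩
    obtain ⟨z, rfl⟩ := G.surjective_toRealization q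
    exact ⟨f z, (hM z hqM).1, (hM z hqM).2, (h3 z (hMP' hqM)).1 hqS⟩
  have hfyN : f y ∈ ON := by
    refine ⟨⟨⟨y, hNP hyN, rfl⟩, ⟨y, hNQ hyN, rfl⟩⟩, (hPQ _ ⟨⟨y, hNP hyN, rfl⟩,
      ⟨y, hNQ hyN, rfl⟩⟩).resolve_left fun h => ?_⟩
    exact disjoint_left.1 hUW (h y rfl) (hNW hyN)
  obtain ⟨hD, hDK⟩ := twoSheet_spec hK (P := OP) (Q := OQ) (N := ON) (fun c hc => hc.1)
    ⟨f y, hfyN⟩ hcov hstep (hmeet P hc.closed_left hc.left_meets hMP)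
    (hmeet Q hc.closed_right hc.right_meets hMQ)
  obtain ⟨h, hh, hfh, hhy⟩ := hy C _ K (K.twoSheet OP OQ ON) hK hD f _
    ⟨⟨f y, false, true⟩, by simp, fun h => absurd hfyN h⟩ hf hDK rfl
  have hfh' : ∀ x, (h x).1.1 = f x := fun x => (congrFun hfh x).symm
  obtain ⟨S, hSP, hS1, hS2, hS⟩ := isClosed_image_piece htr hc.closed_left hh.continuous
    (T := {d | d.1.2.2 = true}) (by
      intro x z hxz hx hxT
      refine ((hh.map_edge _ _ hxz).2.1 ?_ ?_).symm.trans hxT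
      · rw [hfh']
        exact ⟨x, hx, rfl⟩
      · rw [hfh']
        exact ⟨z, by rwa [mem_preimage, ← hE x z hxz], rfl⟩)
  obtain ⟨R, hRQ, hR1, hR2, hR⟩ := isClosed_image_piece htr hc.closed_right hh.continuous
    (T := {d | d.1.2.1 = true}) (by
      intro x z hxz hx hxT
      refine ((hh.map_edge _ _ hxz).2.2 ?_ ?_).symm.trans hxT
      · rw [hfh']
        exact ⟨x, hx, rfl⟩
      · rw [hfh']
        exact ⟨z, by rwa [mem_preimage, ← hE x z hxz], rfl⟩)
  have hfwd : IsForwardPair P Q M N S R := by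
    refine ⟨hSP, hS1, hS2, hRQ, hR1, hR2, ?_, ?_⟩
    · ext q
      obtain ⟨x, rfl⟩ := G.surjective_toRealization q
      refine and_congr_left fun hx => ?_
      rw [hS x (hMP hx), hR x (hMQ hx)]
      have := (h x).2.2 (by rw [hfh']; exact (hM x hx).2)
      simp [this]
    · rintro q ⟨hq, hqN⟩
      obtain ⟨x, rfl⟩ := G.surjective_toRealization q
      exact (hS x (hNP hqN)).2 ((h x).2.1 ((hR x (hNQ hqN)).1 hq))
  have h1 := hrec S R hfwd ((hS y (hNP hyN)).2 (by rw [hhy]; rfl))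
  have h2 := (hR y (hNQ hyN)).1 h1
  rw [hhy] at h2
  exact Bool.false_ne_true h2

theorem IsConfluentFraisseLimit.not_isHomogeneousSpace {V : Type*} [TopologicalSpace V]
    {G : TopGraph V} (hG : IsConfluentFraisseLimit G) : ¬ IsHomogeneousSpace G.Realization := by
  intro hom
  obtain ⟨x, hx⟩ := hG.exists_isRecurrentPoint
  obtain ⟨y, hy⟩ := hG.exists_isGenericVertex
  obtain ⟨h, rfl⟩ := hom (G.toRealization y) x
  exact hy.not_isRecurrentPoint hG (hx.of_homeomorph h)

/-! ### A sequence of finite graphs that solves all extension problems. -/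

/-- Finite connected graphs. -/
structure FiniteConnectedGraph where
  Vertex : Type
  [topology : TopologicalSpace Vertex]
  [discrete : DiscreteTopology Vertex]
  [finite : Finite Vertex]
  graph : TopGraph Vertex
  connected : graph.Connected

namespace FiniteConnectedGraph

attribute [instance] topology discrete finite

/-- An extension problem over `X` with a solution over `Y`. -/
def IsSolvedBy (X Y : FiniteConnectedGraph) (π : Y.Vertex → X.Vertex) {a b : ℕ}
    (K : TopGraph (Fin a)) (L : TopGraph (Fin b)) (f : X.Vertex → Fin a) (g : Fin b → Fin a) : Prop :=
  L.Connected → X.graph.IsConfluentEpi K f → L.IsConfluentEpi K g →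
    ∃ h : Y.Vertex → Fin b, Y.graph.IsConfluentEpi L h ∧ f ∘ π = g ∘ h

/-- There are finitely many problems of size at most `n`. They are amalgamated one at a time, and
earlier solutions persist by composition. -/
theorem exists_isSolvedBy (X : FiniteConnectedGraph) (n : ℕ) :
    ∃ (Y : FiniteConnectedGraph) (π : Y.Vertex → X.Vertex), Y.graph.IsConfluentEpi X.graph π ∧
      ∀ (a b : ℕ), a ≤ n → b ≤ n → ∀ (K : TopGraph (Fin a)) (L : TopGraph (Fin b))
        (f : X.Vertex → Fin a) (g : Fin b → Fin a), X.IsSolvedBy Y π K L f g := by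
  let I : Type := Σ (a b : Fin (n + 1)), TopGraph (Fin a) × TopGraph (Fin b) ×
    (X.Vertex → Fin a) × (Fin b → Fin a)
  have key : ∀ s : Set I, s.Finite → ∃ (Y : FiniteConnectedGraph) (π : Y.Vertex → X.Vertex),
      Y.graph.IsConfluentEpi X.graph π ∧
        ∀ i ∈ s, X.IsSolvedBy Y π i.2.2.1 i.2.2.2.1 i.2.2.2.2.1 i.2.2.2.2.2 := by
    intro s hs
    induction s, hs using Set.Finite.induction_on with
    | empty =>
      exact ⟨X, id, TopGraph.isConfluentEpi_of_equiv (Equiv.refl _) continuous_id continuous_id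
        fun _ _ => Iff.rfl, by simp⟩
    | @insert i s _ _ ih =>
      obtain ⟨Y, π, hπ, hY⟩ := ih
      by_cases hi : i.2.2.2.1.Connected ∧ X.graph.IsConfluentEpi i.2.2.1 i.2.2.2.2.1 ∧
          i.2.2.2.1.IsConfluentEpi i.2.2.1 i.2.2.2.2.2
      · obtain ⟨hL, hf, hg⟩ := hi
        obtain ⟨y⟩ := Y.connected.1
        obtain ⟨b, hb⟩ := hg.surjective (i.2.2.2.2.1 (π y))
        obtain ⟨D, j1, j2, j3, N, p, q, -, hN, hp, hq, hpq, -, -⟩ :=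
          TopGraph.exists_amalgam Y.connected hL (hf.comp hπ) hg (b := y) (c := b) hb.symm
        refine ⟨⟨D, N, hN⟩, π ∘ p, hπ.comp hp, ?_⟩
        rintro j (rfl | hj)
        · exact fun _ _ _ => ⟨q, hq, hpq⟩
        · intro h1 h2 h3
          obtain ⟨h, hh, hfh⟩ := hY j hj h1 h2 h3
          exact ⟨h ∘ p, hh.comp hp, by
            rw [← Function.comp_assoc, hfh, Function.comp_assoc]⟩
      · refine ⟨Y, π, hπ, ?_⟩
        rintro j (rfl | hj)
        · exact fun h1 h2 h3 => absurd ⟨h1, h2, h3⟩ hi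
        · exact hY j hj
  obtain ⟨Y, π, hπ, hY⟩ := key univ (toFinite _)
  exact ⟨Y, π, hπ, fun a b ha hb K L f g =>
    hY ⟨⟨a, Nat.lt_succ_of_le ha⟩, ⟨b, Nat.lt_succ_of_le hb⟩, K, L, f, g⟩ (mem_univ _)⟩

/-- The graph with one vertex. -/
def point : FiniteConnectedGraph where
  Vertex := Fin 1
  graph := ⟨fun _ _ => True, fun _ => trivial, fun _ _ _ => trivial, isClosed_discrete _⟩
  connected := (TopGraph.connected_iff_reach _).2 ⟨⟨0⟩, fun a b => by
    rw [Subsingleton.elim a b]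
    exact ReflTransGen.refl⟩

/-- A sequence of finite connected graphs in which all extension problems get solved. -/
noncomputable def genericSequence : ℕ → FiniteConnectedGraph
  | 0 => point
  | n + 1 => (exists_isSolvedBy (genericSequence n) n).choose

theorem genericSequence_spec (n : ℕ) :
    ∃ π : (genericSequence (n + 1)).Vertex → (genericSequence n).Vertex,
      (genericSequence (n + 1)).graph.IsConfluentEpi (genericSequence n).graph π ∧
      ∀ (a b : ℕ), a ≤ n → b ≤ n → ∀ (K : TopGraph (Fin a)) (L : TopGraph (Fin b))
        (f : (genericSequence n).Vertex → Fin a) (g : Fin b → Fin a),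
        (genericSequence n).IsSolvedBy (genericSequence (n + 1)) π K L f g :=
  (exists_isSolvedBy (genericSequence n) n).choose_spec

end FiniteConnectedGraph

open FiniteConnectedGraph TopGraph

/-! ### Inverse limits of finite graphs. -/

/-- The threads of an inverse sequence. -/
abbrev InverseLimit {A : ℕ → Type} (π : ∀ n, A (n + 1) → A n) : Type :=
  {x : ∀ n, A n // ∀ n, π n (x (n + 1)) = x n}

namespace InverseLimit

variable {A : ℕ → Type} {π : ∀ n, A (n + 1) → A n}

theorem rel_of_le {R : ∀ n, A n → A n → Prop}
    (hR : ∀ n a b, R (n + 1) a b → R n (π n a) (π n b)) {x y : InverseLimit π} {m n : ℕ}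
    (hmn : m ≤ n) (h : R n (x.1 n) (y.1 n)) : R m (x.1 m) (y.1 m) := by
  induction n, hmn using Nat.le_induction with
  | base => exact h
  | succ n _ ih =>
    refine ih ?_
    rw [← x.2 n, ← y.2 n]
    exact hR n _ _ h

theorem eq_of_le {x y : InverseLimit π} {m n : ℕ} (hmn : m ≤ n) (h : x.1 n = y.1 n) :
    x.1 m = y.1 m :=
  rel_of_le (R := fun _ a b => a = b) (fun n _ _ h => congrArg (π n) h) hmn h

theorem exists_partial_thread [∀ n, Nonempty (A n)] (n : ℕ) (c : A n) :
    ∃ x : ∀ n, A n, x n = c ∧ ∀ j < n, π j (x (j + 1)) = x j := by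
  induction n with
  | zero =>
    classical
    exact ⟨Function.update (fun n => Classical.arbitrary (A n)) 0 c, by simp, by simp⟩
  | succ n ih =>
    classical
    obtain ⟨x, hx, hx'⟩ := ih (π n c)
    refine ⟨Function.update x (n + 1) c, by simp, fun j hj => ?_⟩
    rw [Function.update_of_ne (by omega : j ≠ n + 1)]
    rcases Nat.lt_succ_iff_lt_or_eq.1 hj with h | rfl
    · rw [Function.update_of_ne (by omega : j + 1 ≠ n + 1), hx' j h]
    · rw [Function.update_self, hx]

theorem continuous_proj [∀ n, TopologicalSpace (A n)] (n : ℕ) :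
    Continuous fun x : InverseLimit π => x.1 n :=
  (continuous_apply n).comp continuous_subtype_val

variable [∀ n, TopologicalSpace (A n)] [∀ n, DiscreteTopology (A n)]

theorem isClosed_threads : IsClosed {x : ∀ n, A n | ∀ n, π n (x (n + 1)) = x n} := by
  simp only [ofPred_forall]
  exact isClosed_iInter fun n => isClosed_eq
    (continuous_of_discreteTopology.comp (continuous_apply _)) (continuous_apply _)

variable [∀ n, Finite (A n)]

instance compactSpace : CompactSpace (InverseLimit π) :=
  isCompact_iff_compactSpace.1 isClosed_threads.isCompact

/-- Threads through given sets. -/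
theorem exists_thread [∀ n, Nonempty (A n)] {C : ∀ n, Set (A n)} {n : ℕ}
    (hup : ∀ m, n ≤ m → ∀ c ∈ C m, ∃ d ∈ C (m + 1), π m d = c)
    (hdown : ∀ m, n ≤ m → ∀ d ∈ C (m + 1), π m d ∈ C m) {m : ℕ} (hnm : n ≤ m) {c : A m}
    (hc : c ∈ C m) : ∃ x : InverseLimit π, x.1 m = c ∧ ∀ j, n ≤ j → x.1 j ∈ C j := by
  let T : ℕ → Set (∀ n, A n) := fun k =>
    {x | x m = c} ∩ {x | x (m + k) ∈ C (m + k)} ∩ ⋂ j ∈ Iio (m + k), {x | π j (x (j + 1)) = x j}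
  have hTcl : ∀ k, IsClosed (T k) := fun k => by
    refine (IsClosed.inter ?_ ?_).inter (isClosed_biInter fun j _ => ?_)
    · exact isClosed_eq (continuous_apply _) continuous_const
    · exact (isClosed_discrete (C (m + k))).preimage (continuous_apply _)
    · exact isClosed_eq (continuous_of_discreteTopology.comp (continuous_apply _))
        (continuous_apply _)
  have hTne : ∀ k, (T k).Nonempty := by
    intro k
    induction k with
    | zero =>
      obtain ⟨x, hx, hx'⟩ := exists_partial_thread (π := π) m c
      refine ⟨x, ⟨hx, ?_⟩, mem_iInter₂.2 fun j hj => hx' j hj⟩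
      change x m ∈ C m
      rwa [hx]
    | succ k ih =>
      classical
      obtain ⟨x, ⟨hx1, hx2⟩, hx3⟩ := ih
      obtain ⟨d, hd, hdx⟩ := hup (m + k) (by omega) _ hx2
      refine ⟨Function.update x (m + k + 1) d, ⟨?_, ?_⟩, mem_iInter₂.2 fun j hj => ?_⟩
      · change Function.update x (m + k + 1) d m = c
        rw [Function.update_of_ne (by omega : m ≠ m + k + 1)]
        exact hx1
      · change Function.update x (m + k + 1) d (m + k + 1) ∈ C (m + k + 1)
        rwa [Function.update_self]
      · have hj' : j < m + k + 1 := hj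
        change π j (Function.update x (m + k + 1) d (j + 1)) = Function.update x (m + k + 1) d j
        rw [Function.update_of_ne (by omega : j ≠ m + k + 1)]
        rcases Nat.lt_succ_iff_lt_or_eq.1 hj' with h | rfl
        · rw [Function.update_of_ne (by omega : j + 1 ≠ m + k + 1)]
          exact mem_iInter₂.1 hx3 j h
        · rw [Function.update_self, hdx]
  have hTmono : ∀ k, T (k + 1) ⊆ T k := by
    rintro k x ⟨⟨hx1, hx2⟩, hx3⟩
    have hx3' := mem_iInter₂.1 hx3
    refine ⟨⟨hx1, ?_⟩, mem_iInter₂.2 fun j hj => hx3' j (lt_trans (mem_Iio.1 hj) (by omega))⟩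
    have h := hx3' (m + k) (show m + k < m + (k + 1) by omega)
    change x (m + k) ∈ C (m + k)
    rw [← show π (m + k) (x (m + k + 1)) = x (m + k) from h]
    exact hdown _ (by omega) _ hx2
  obtain ⟨x, hx⟩ := IsCompact.nonempty_iInter_of_sequence_nonempty_isCompact_isClosed T hTmono hTne
    (hTcl 0).isCompact hTcl
  rw [mem_iInter] at hx
  have hthread : ∀ j, π j (x (j + 1)) = x j := fun j =>
    mem_iInter₂.1 (hx (j + 1)).2 j (show j < m + (j + 1) by omega)
  refine ⟨⟨x, hthread⟩, (hx 0).1.1, fun j hj => ?_⟩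
  have key : ∀ k, x (j + k) ∈ C (j + k) → x j ∈ C j := by
    intro k
    induction k with
    | zero => exact id
    | succ k ih =>
      intro h
      refine ih ?_
      rw [← hthread (j + k)]
      exact hdown _ (by omega) _ h
  refine key m ?_
  rw [Nat.add_comm]
  exact (hx j).1.2

theorem surjective_proj [∀ n, Nonempty (A n)] (hπ : ∀ n, Function.Surjective (π n)) (n : ℕ) :
    Function.Surjective fun x : InverseLimit π => x.1 n := fun c => by
  obtain ⟨x, hx, -⟩ := exists_thread (π := π) (C := fun _ => univ) (n := n)
    (fun m _ c _ => (hπ m c).imp fun _ h => ⟨mem_univ _, h⟩) (fun _ _ _ _ => mem_univ _) le_rfl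
    (mem_univ c)
  exact ⟨x, hx⟩

/-- Compactness: the pairs in `Z` related at level `n` form a decreasing sequence of nonempty closed
sets. It turns approximate edges into edges of the limit. -/
theorem exists_rel {R : ∀ n, A n → A n → Prop}
    (hR : ∀ n a b, R (n + 1) a b → R n (π n a) (π n b)) {Z : Set (InverseLimit π × InverseLimit π)}
    (hZ : IsClosed Z) (h : ∀ n, ∃ p ∈ Z, R n (p.1.1 n) (p.2.1 n)) :
    ∃ p ∈ Z, ∀ n, R n (p.1.1 n) (p.2.1 n) := by
  let T : ℕ → Set (InverseLimit π × InverseLimit π) := fun n => Z ∩ {p | R n (p.1.1 n) (p.2.1 n)}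
  have hTcl : ∀ n, IsClosed (T n) := fun n => hZ.inter
    ((isClosed_discrete {q : A n × A n | R n q.1 q.2}).preimage
      (((continuous_proj n).comp continuous_fst).prodMk ((continuous_proj n).comp continuous_snd)))
  obtain ⟨p, hp⟩ := IsCompact.nonempty_iInter_of_sequence_nonempty_isCompact_isClosed T
    (fun n p hp => ⟨hp.1, rel_of_le hR (Nat.le_succ n) hp.2⟩) h (hTcl 0).isCompact hTcl
  rw [mem_iInter] at hp
  exact ⟨p, (hp 0).1, fun n => (hp n).2⟩

theorem exists_eq_imp {Z : Set (InverseLimit π × InverseLimit π)} (hZ : IsClosed Z)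
    (hZd : ∀ x, (x, x) ∉ Z) : ∃ n, ∀ x y : InverseLimit π, x.1 n = y.1 n → (x, y) ∉ Z := by
  by_contra! hcon
  obtain ⟨⟨x, y⟩, hp, h⟩ := exists_rel (R := fun _ a b => a = b) (fun n _ _ h => congrArg (π n) h) hZ
    fun n => by
      obtain ⟨x, y, hxy, h⟩ := hcon n
      exact ⟨(x, y), h, hxy⟩
  obtain rfl : x = y := Subtype.ext (funext h)
  exact hZd x hp

/-- The graph on the threads of an inverse sequence of graphs. -/
def graph (X : ∀ n, TopGraph (A n)) (π : ∀ n, A (n + 1) → A n) : TopGraph (InverseLimit π) where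
  Edge x y := ∀ n, (X n).Edge (x.1 n) (y.1 n)
  refl _ n := (X n).refl _
  symm _ _ h n := (X n).symm _ _ (h n)
  closed := by
    simp only [ofPred_forall]
    exact isClosed_iInter fun n => (isClosed_discrete {q : A n × A n | (X n).Edge q.1 q.2}).preimage
      (((continuous_proj n).comp continuous_fst).prodMk ((continuous_proj n).comp continuous_snd))

theorem isEpi_proj [∀ n, Nonempty (A n)] {X : ∀ n, TopGraph (A n)}
    (hπ : ∀ n, (X (n + 1)).IsEpi (X n) (π n)) (n : ℕ) :
    (graph X π).IsEpi (X n) fun x => x.1 n where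
  continuous := continuous_proj n
  map_edge _ _ h := h n
  surjective := surjective_proj (fun n => (hπ n).surjective) n
  surjective_edge c d hcd := by
    have hs := surjective_proj (π := π) fun n => (hπ n).surjective
    have key : ∀ k, ∃ x y : InverseLimit π, x.1 n = c ∧ y.1 n = d ∧
        (X (n + k)).Edge (x.1 (n + k)) (y.1 (n + k)) := by
      intro k
      induction k with
      | zero =>
        obtain ⟨x, rfl⟩ := hs n c
        obtain ⟨y, rfl⟩ := hs n d
        exact ⟨x, y, rfl, rfl, hcd⟩
      | succ k ih =>
        obtain ⟨x, y, rfl, rfl, hxy⟩ := ih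
        obtain ⟨a, b, hab, ha, hb⟩ := (hπ (n + k)).surjective_edge _ _ hxy
        obtain ⟨x', rfl⟩ := hs (n + k + 1) a
        obtain ⟨y', rfl⟩ := hs (n + k + 1) b
        refine ⟨x', y', eq_of_le (Nat.le_add_right n k) ?_, eq_of_le (Nat.le_add_right n k) ?_, hab⟩
        · rw [← ha, ← x'.2]
        · rw [← hb, ← y'.2]
    obtain ⟨⟨x, y⟩, ⟨hx, hy⟩, h⟩ := exists_rel (π := π) (R := fun n => (X n).Edge)
      (fun n => (hπ n).map_edge) (Z := {p | p.1.1 n = c ∧ p.2.1 n = d})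
      ((isClosed_eq ((continuous_proj n).comp continuous_fst) continuous_const).inter
        (isClosed_eq ((continuous_proj n).comp continuous_snd) continuous_const)) fun k => by
      obtain ⟨x, y, hx, hy, hxy⟩ := key k
      exact ⟨(x, y), ⟨hx, hy⟩, rel_of_le (R := fun n => (X n).Edge) (fun n => (hπ n).map_edge) (Nat.le_add_left k n) hxy⟩
    exact ⟨x, y, h, hx, hy⟩

/-- From `Q` upwards, the components `C m` through the coordinates of `a` map onto one another, and
their threads form a set that projects onto `Q`. It is connected: a separation would have edges
between its parts at every level, hence by `exists_rel` an edge in the limit. -/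
theorem isConfluentEpi_proj [∀ n, Nonempty (A n)] {X : ∀ n, TopGraph (A n)}
    (hπ : ∀ n, (X (n + 1)).IsConfluentEpi (X n) (π n)) (n : ℕ) :
    (graph X π).IsConfluentEpi (X n) fun x => x.1 n where
  toIsEpi := isEpi_proj (fun n => (hπ n).toIsEpi) n
  confluent Q hQ a ha := by
    let F : ∀ m, n ≤ m → Set (A m) → Set (A (m + 1)) := fun m _ s =>
      (X (m + 1)).component (π m ⁻¹' s) (a.1 (m + 1))
    let C : ∀ m, Set (A m) := fun m =>
      if h : n ≤ m then Nat.leRec (motive := fun m _ => Set (A m)) Q F h else univ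
    have hC0 : C n = Q := by simp [C, Nat.leRec_self]
    have hC1 : ∀ m, n ≤ m → C (m + 1) = (X (m + 1)).component (π m ⁻¹' C m) (a.1 (m + 1)) := by
      intro m hm
      simp only [C, hm, Nat.le_succ_of_le hm, dif_pos]
      rw [Nat.leRec_succ _ _ hm]
    have hCa : ∀ m, n ≤ m → a.1 m ∈ C m := by
      intro m hm
      induction m, hm using Nat.le_induction with
      | base => exact hC0 ▸ ha
      | succ m hm ih =>
        rw [hC1 m hm]
        refine mem_component_self _ ?_
        rwa [mem_preimage, a.2 m]
    have hCc : ∀ m, n ≤ m → (X m).ConnectedSet (C m) := by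
      intro m hm
      induction m, hm using Nat.le_induction with
      | base => exact hC0 ▸ hQ
      | succ m hm ih =>
        rw [hC1 m hm]
        exact connectedSet_component _ _ _
    have hCπ : ∀ m, n ≤ m → π m '' C (m + 1) = C m := by
      intro m hm
      rw [hC1 m hm]
      refine (hπ m).confluent _ (hCc m hm) _ ?_
      rw [mem_preimage, a.2 m]
      exact hCa m hm
    have hthread : ∀ m, n ≤ m → ∀ c ∈ C m, ∃ x : InverseLimit π, x.1 m = c ∧
        ∀ j, n ≤ j → x.1 j ∈ C j := fun m hm c hc =>
      exists_thread (fun m hm c hc => (hCπ m hm).symm.subset hc)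
        (fun m hm d hd => (hCπ m hm).subset ⟨d, hd, rfl⟩) hm hc
    have hLcl : IsClosed {x : InverseLimit π | ∀ j, n ≤ j → x.1 j ∈ C j} := by
      simp only [ofPred_forall]
      exact isClosed_iInter fun j => isClosed_iInter fun _ =>
        (isClosed_discrete (C j)).preimage (continuous_proj j)
    refine image_component_eq (C := {x : InverseLimit π | ∀ j, n ≤ j → x.1 j ∈ C j}) ?_ hCa
      (fun x hx => hC0 ▸ hx n le_rfl) fun c hc => ?_
    · rintro ⟨P, R, hPne, ⟨r, hr⟩, hP, hR, hPR, hne⟩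
      have hPR' : ∀ x ∈ P ∪ R, ∀ j, n ≤ j → x.1 j ∈ C j := fun x hx => hPR.subset hx
      have hcl : ∀ S ⊆ P ∪ R,
          IsClosed ((↑) ⁻¹' S : Set {x : InverseLimit π | ∀ j, n ≤ j → x.1 j ∈ C j}) → IsClosed S := by
        intro S hS h
        have := hLcl.isClosedEmbedding_subtypeVal.isClosedMap _ h
        rwa [Subtype.image_preimage_coe, inter_eq_right.2 (hPR ▸ hS)] at this
      obtain ⟨⟨x, y⟩, ⟨hx, hy⟩, h⟩ := exists_rel (π := π) (R := fun n => (X n).Edge)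
        (fun n => (hπ n).map_edge) (Z := P ×ˢ R)
        ((hcl P subset_union_left hP).prod (hcl R subset_union_right hR)) fun m => by
        have hm : n ≤ max n m := le_max_left _ _
        by_contra! hcon
        have hsub := (hCc _ hm).subset_of_closed (U := (fun x : InverseLimit π => x.1 (max n m)) '' P)
          (isClosed_discrete _) (isOpen_discrete _) (by
            rintro _ ⟨-, x, hx, rfl⟩ b hb hxb
            obtain ⟨y, rfl, hy⟩ := hthread _ hm b hb
            rcases hPR.symm.subset hy with hy' | hy'
            · exact ⟨y, hy', rfl⟩
            · exact absurd (rel_of_le (R := fun n => (X n).Edge) (fun n => (hπ n).map_edge) (le_max_right n m) hxb)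
                (hcon (x, y) ⟨hx, hy'⟩)) (by
            obtain ⟨p, hp⟩ := hPne
            exact ⟨p.1 _, hPR' p (Or.inl hp) _ hm, p, hp, rfl⟩)
        obtain ⟨x, hx, hxr⟩ := hsub (hPR' r (Or.inr hr) _ hm)
        refine hcon (x, r) ⟨hx, hr⟩ ?_
        have h' : x.1 m = r.1 m := eq_of_le (le_max_right n m) hxr
        change (X m).Edge (x.1 m) (r.1 m)
        rw [h']
        exact (X m).refl _
      exact hne x hx y hy h
    · obtain ⟨x, hx, hx'⟩ := hthread n le_rfl c (hC0.symm ▸ hc)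
      exact ⟨x, hx', hx⟩

/-- The inverse limit of a sequence in which all extension problems get solved is a projective
Fraïssé limit. -/
theorem isConfluentFraisseLimit_graph {X : ∀ n, TopGraph (A n)}
    (hπ : ∀ n, (X (n + 1)).IsConfluentEpi (X n) (π n)) (hX : ∀ n, (X n).Connected)
    (hsolve : ∀ n (a b : ℕ), a ≤ n → b ≤ n → ∀ (K : TopGraph (Fin a)) (L : TopGraph (Fin b))
      (f : A n → Fin a) (g : Fin b → Fin a), L.Connected → (X n).IsConfluentEpi K f →
      L.IsConfluentEpi K g →
      ∃ h : A (n + 1) → Fin b, (X (n + 1)).IsConfluentEpi L h ∧ f ∘ π n = g ∘ h) :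
    IsConfluentFraisseLimit (graph X π) := by
  have hne : ∀ n, Nonempty (A n) := fun n => (hX n).1
  have hproj := isConfluentEpi_proj hπ
  have hext : ∀ (B C : Type) [Finite B] [TopologicalSpace B] [DiscreteTopology B]
      [Finite C] [TopologicalSpace C] [DiscreteTopology C] (K : TopGraph B) (L : TopGraph C),
      K.Connected → L.Connected → ∀ (f : InverseLimit π → B) (g : C → B),
      (graph X π).IsConfluentEpi K f → L.IsConfluentEpi K g →
      ∃ h : InverseLimit π → C, (graph X π).IsConfluentEpi L h ∧ f = g ∘ h := by
    intro B C _ _ _ _ _ _ K L hK hL f g hf hg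
    obtain ⟨n, hn⟩ := exists_eq_imp (π := π) (Z := {p | f p.1 ≠ f p.2})
      ((isClosed_discrete {q : B × B | q.1 ≠ q.2}).preimage
        ((hf.continuous.comp continuous_fst).prodMk (hf.continuous.comp continuous_snd)))
      (fun x h => h rfl)
    obtain ⟨a, ⟨e⟩⟩ := Finite.exists_equiv_fin B
    obtain ⟨b, ⟨e'⟩⟩ := Finite.exists_equiv_fin C
    -- Level `N` is high enough for `f` to factor through it and for the problem to be among those
    -- solved at the next level.
    let N := max n (max a b)
    let σ : A N → B := fun c => f (Function.surjInv (hproj N).surjective c)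
    have hσ : (σ ∘ fun x : InverseLimit π => x.1 N) = f := funext fun x => by
      have h := Function.surjInv_eq (hproj N).surjective (x.1 N)
      by_contra hcon
      exact hn _ _ (eq_of_le (le_max_left _ _) h) hcon
    have hσK : (X N).IsConfluentEpi K σ :=
      IsConfluentEpi.of_comp continuous_of_discreteTopology (hσ.symm ▸ hf) (hproj N).toIsEpi
    obtain ⟨h, hh, hσh⟩ := hsolve N a b ((le_max_left a b).trans (le_max_right _ _))
      ((le_max_right a b).trans (le_max_right _ _)) (K.transport e) (L.transport e') (e ∘ σ)
      (e ∘ g ∘ e'.symm) (hL.of_isEpi (L.isConfluentEpi_transport e').toIsEpi)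
      ((K.isConfluentEpi_transport e).comp hσK)
      ((K.isConfluentEpi_transport e).comp (hg.comp (L.isConfluentEpi_transport_symm e')))
    refine ⟨_, ((L.isConfluentEpi_transport_symm e').comp hh).comp (hproj (N + 1)), ?_⟩
    funext x
    apply e.injective
    have := congrFun hσh (x.1 (N + 1))
    simp only [Function.comp_apply, x.2 N] at this
    rw [← hσ]
    exact this
  have hsc : ∀ n, SecondCountableTopology (A n) := fun _ => inferInstance
  refine ⟨inferInstance, inferInstance, inferInstance,
    TopologicalSpace.Subtype.secondCountableTopology {x : ∀ n, A n | ∀ n, π n (x (n + 1)) = x n},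
    ?_, hext, ?_⟩
  · intro B _ _ _ K hK
    -- Universality is the extension property over the one-vertex graph.
    have hpt : ∀ (C : Type) [TopologicalSpace C] [DiscreteTopology C] (L : TopGraph C),
        L.Connected → L.IsConfluentEpi point.graph fun _ => (0 : Fin 1) := by
      intro C _ _ L hL
      have := hL.1
      exact isConfluentEpi_of_liftsEdges point.connected (fun _ _ _ => trivial) fun a d _ =>
        ⟨a, ReflTransGen.refl, (Subsingleton.elim (α := Fin 1) _ _)⟩
    obtain ⟨h, hh, -⟩ := hext point.Vertex B point.graph K point.connected hK _ _
      ((hpt _ _ (hX 0)).comp (hproj 0)) (hpt B K hK)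
    exact ⟨h, hh⟩
  · intro m hm ε hε
    have hd := @continuous_dist _ m.toPseudoMetricSpace
    rw [hm] at hd
    obtain ⟨n, hn⟩ := exists_eq_imp (π := π) (Z := {p | ε / 2 ≤ m.dist p.1 p.2})
      (isClosed_le continuous_const hd) (fun x h => by
        have : m.dist x x = 0 := m.dist_self x
        simp only [mem_ofPred_eq, this] at h
        linarith)
    refine ⟨A n, inferInstance, inferInstance, inferInstance, X n, fun x => x.1 n, hX n, hproj n,
      fun c => ?_⟩
    have hdiam := @Metric.diam_le_of_forall_dist_le (InverseLimit π)
      ((fun x : InverseLimit π => x.1 n) ⁻¹' {c}) m.toPseudoMetricSpace (ε / 2) (by linarith) fun x hx y hy =>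
        (not_le.1 (hn x y (Eq.trans (mem_singleton_iff.1 hx) (mem_singleton_iff.1 hy).symm))).le
    exact hdiam.trans_lt (half_lt_self hε)

end InverseLimit

theorem exists_isConfluentFraisseLimit :
    ∃ (V : Type) (_ : TopologicalSpace V) (G : TopGraph V), IsConfluentFraisseLimit G := by
  choose π hπ hsolve using genericSequence_spec
  exact ⟨_, _, _, InverseLimit.isConfluentFraisseLimit_graph
    (X := fun n => (genericSequence n).graph) hπ (fun n => (genericSequence n).connected) hsolve⟩

theorem theorem9p1 :
    (∃ (V : Type) (_ : TopologicalSpace V) (G : TopGraph V), IsConfluentFraisseLimit G) ∧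
    ∀ (V : Type u) [TopologicalSpace V] (G : TopGraph V), IsConfluentFraisseLimit G →
      (∀ a b c : V, G.Edge a b → G.Edge b c → G.Edge a c) ∧
      IsContinuum G.Realization ∧
      ¬ IsHomogeneousSpace G.Realization :=
  ⟨exists_isConfluentFraisseLimit, fun _ _ _ hG =>
    ⟨hG.edge_trans, hG.isContinuum_realization, hG.not_isHomogeneousSpace⟩⟩
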